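/- Let $\mathcal X$ be a real Hilbert space. Let $A$ be a linear, in general unbounded, maximal monotone operator in $\mathcal X$, and let $B$ be a bounded linear operator on $\mathcal X$ which is coercive with constant $\beta>0$: $\langle Bx,x\rangle\ge\beta\|x\|^2$ for all $x$. Let $K\beta>\tfrac12$, $\eta:=2K\beta-1>0$, let $n\ge1$ be real, and let $\psi:[0,\infty)\to(0,\infty)$ be continuous. Consider the closed-loop system $$\dot X(t)+AX(t)=-K\psi(t)^nBX(t)+d(t),\quad t\ge t_0,\qquad X(t_0)=X_0,$$ with $t_0\ge0$, $X_0\in\overline{D(A)}=\mathcal X$, $d\in L^\infty(\mathbb R_+;\mathcal X)$, and $\|d\|_\infty$ the essential supremum of $\|d(t)\|$ over $t\ge0$. Its mild solutions are the continuous solutions of $$X(t)=S(t-t_0)X_0+\int_{t_0}^tS(t-s)\bigl(-K\psi(s)^nBX(s)+d(s)\bigr)\,ds,$$ where $S$ is the contraction semigroup generated by $-A$. As usual, $\mathcal K$ is the class of continuous strictly increasing functions $\mathbb R_+\to\mathbb R_+$ vanishing at $0$, $\mathcal K_\infty$ the class of its unbounded members, and $\mathcal{KL}$ the class of continuous $b:\mathbb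 R_+\times\mathbb R_+\to\mathbb R_+$ with $b(\cdot,t)\in\mathcal K$ for each $t$ and $b(r,\cdot)$ strictly decreasing to $0$ for each $r>0$. Then: (1) $A+K\psi(t)^nB$ is maximal monotone (that is, $m$-accretive) for all $t\ge0$, and there is exactly one mild solution on $[t_0,\infty)$ for all $t_0$, $X_0$, $d$ as above. (2) The mild solution with $t_0=0$ satisfies, for all $t\ge0$, $$\|X(t)\|^2\le e^{-\eta\int_0^t\psi(r)^n\,dr}\,\|X_0\|^2+\|d\|_\infty^2\int_0^t\frac{e^{-\eta\int_s^t\psi(r)^n\,dr}}{\psi(s)^n}\,ds .$$ (3) If $\psi$ is nondecreasing, the closed-loop system is input-to-state stable: there are $b\in\mathcal{KL}$ and $\gamma\in\mathcal K_\infty$ with $\|X(t)\|\le b(\|X_0\|,t-t_0)+\gamma(\|d\|_\infty)$ for all $t\ge t_0\ge0$, $X_0$ and $d$. If moreover $\psi(t)\to\infty$ as $t\to\infty$, the undisturbed dynamics decay hyperexponentially: there are $\kappa_0\ge0$ and $\rho,\kappa\in\mathcal K_\infty$ such that, for $d=0$, $\|X(t)\|\le e^{-(\kappa(t-t_0)+\kappa_0)(t-t_0)}\rho(\|X_0\|)$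 for all $t\ge t_0\ge0$ and all $X_0$. (4) If $\psi(t)=1+t$, the mild solution with $t_0=0$ satisfies $$\|X(t)\|^2\le e^{-\eta t(t+2)/2}\,\|X_0\|^2+\frac{C}{\psi(t)^2}\,\|d\|_\infty^2,\qquad t\ge0,$$ with a constant $C>0$ that depends only on $K$ and $\beta$ (not on $t$, $X_0$, $d$, $n$, $A$, $B$ or $\mathcal X$). Moreover the system is uniformly hyperexponentially stable: there are $\kappa_0\ge0$, $\rho,\kappa\in\mathcal K_\infty$ and $b\in\mathcal{KL}$ with $\|X(t)\|\le e^{-(\kappa(t-t_0)+\kappa_0)(t-t_0)}\rho(\|X_0\|)+b(\|d\|_\infty,t-t_0)$ for all $t\ge t_0\ge0$, all $X_0$ and all $d\in L^\infty(\mathbb R_+;\mathcal X)$. -/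

import Mathlib

open Set Filter Topology MeasureTheory
open scoped ENNReal InnerProductSpace

section Operators

variable {𝒳 : Type*} [NormedAddCommGroup 𝒳] [InnerProductSpace ℝ 𝒳]

/-- A linear operator `A`, defined on a subspace of `𝒳`, is monotone if `⟪A x, x⟫ ≥ 0` on its
domain. -/
def MonotoneOperator (A : 𝒳 →ₗ.[ℝ] 𝒳) : Prop :=
  ∀ x : A.domain, 0 ≤ ⟪A x, (x : 𝒳)⟫_ℝ

/-- `A` is maximal monotone: it is monotone, and its graph has no proper monotone extension in
`𝒳 × 𝒳` (every pair which is monotonically related to the graph belongs to the graph). -/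
def MaximalMonotone (A : 𝒳 →ₗ.[ℝ] 𝒳) : Prop :=
  MonotoneOperator A ∧
    ∀ u v : 𝒳, (∀ x : A.domain, 0 ≤ ⟪v - A x, u - (x : 𝒳)⟫_ℝ) → (u, v) ∈ A.graph

/-- Coercivity of a bounded operator `B` with constant `β > 0`. -/
def CoerciveWith (B : 𝒳 →L[ℝ] 𝒳) (β : ℝ) : Prop :=
  0 < β ∧ ∀ x : 𝒳, β * ‖x‖ ^ 2 ≤ ⟪B x, x⟫_ℝ

/-- A strongly continuous semigroup of linear contractions `S t`, `t ≥ 0` (the values at negative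
times are irrelevant). -/
structure IsContractionSemigroup (S : ℝ → 𝒳 →L[ℝ] 𝒳) : Prop where
  zero : S 0 = ContinuousLinearMap.id ℝ 𝒳
  add : ∀ s t : ℝ, 0 ≤ s → 0 ≤ t → S (s + t) = (S s).comp (S t)
  continuousOn : ∀ x : 𝒳, ContinuousOn (fun t => S t x) (Ici 0)
  contraction : ∀ t : ℝ, 0 ≤ t → ∀ x : 𝒳, ‖S t x‖ ≤ ‖x‖

/-- The infinitesimal generator of `S` is `-A`: the domain of `A` consists of those `x` for which
`(x - S h x) / h` converges as `h → 0+`, and the limit is then `A x`. -/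
def HasGeneratorNeg (S : ℝ → 𝒳 →L[ℝ] 𝒳) (A : 𝒳 →ₗ.[ℝ] 𝒳) : Prop :=
  ∀ x y : 𝒳, (x, y) ∈ A.graph ↔
    Tendsto (fun h : ℝ => h⁻¹ • (x - S h x)) (𝓝[>] 0) (𝓝 y)

/-- `X` is a mild solution on `[t₀, ∞)` of `X' + A X = f(t) X + d`, `X(t₀) = X₀`: it is continuous
and satisfies the Duhamel formula with the contraction semigroup generated by `-A`. -/
def IsMildSolution (A : 𝒳 →ₗ.[ℝ] 𝒳) (f : ℝ → 𝒳 →L[ℝ] 𝒳) (d : ℝ → 𝒳) (t₀ : ℝ) (X₀ : 𝒳)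
    (X : ℝ → 𝒳) : Prop :=
  ∃ S : ℝ → 𝒳 →L[ℝ] 𝒳, IsContractionSemigroup S ∧ HasGeneratorNeg S A ∧
    ContinuousOn X (Ici t₀) ∧
    ∀ t : ℝ, t₀ ≤ t →
      IntervalIntegrable (fun s => f s (X s) + d s) volume t₀ t ∧
      X t = S (t - t₀) X₀ + ∫ s in t₀..t, S (t - s) (f s (X s) + d s)

/-- The set of disturbances `L^∞(ℝ₊; 𝒳)`. -/
def LInfty (𝒳 : Type*) [NormedAddCommGroup 𝒳] : Set (ℝ → 𝒳) :=
  {d | MemLp d ∞ (volume.restrict (Ici (0 : ℝ)))}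

/-- The norm `‖d‖_∞ = ess sup_{t ≥ 0} ‖d(t)‖`, meant for `d ∈ L^∞(ℝ₊; 𝒳)`. -/
noncomputable def supNorm (d : ℝ → 𝒳) : ℝ :=
  (eLpNorm d ∞ (volume.restrict (Ici (0 : ℝ)))).toReal

/-- The time-varying linear feedback `-K ψ(t)^n B`. -/
noncomputable def feedback (K n : ℝ) (ψ : ℝ → ℝ) (B : 𝒳 →L[ℝ] 𝒳) : ℝ → 𝒳 →L[ℝ] 𝒳 :=
  fun t => -((K * ψ t ^ n) • B)

end Operators

section Stability

/-- Class `𝒦` functions on `ℝ₊`. -/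
def ClassK (α : ℝ → ℝ) : Prop :=
  ContinuousOn α (Ici 0) ∧ α 0 = 0 ∧ StrictMonoOn α (Ici 0)

/-- Class `𝒦_∞` functions on `ℝ₊`. -/
def ClassKInfty (α : ℝ → ℝ) : Prop :=
  ClassK α ∧ Tendsto α atTop atTop

/-- Class `𝒦ℒ` functions on `ℝ₊ × ℝ₊`. -/
def ClassKL (b : ℝ → ℝ → ℝ) : Prop :=
  ContinuousOn (fun p : ℝ × ℝ => b p.1 p.2) (Ici 0 ×ˢ Ici 0) ∧
    (∀ t : ℝ, 0 ≤ t → ClassK fun r => b r t) ∧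
    ∀ r : ℝ, 0 < r → StrictAntiOn (b r) (Ici 0) ∧ Tendsto (b r) atTop (𝓝 0)

variable {𝒳 : Type*} [NormedAddCommGroup 𝒳] [InnerProductSpace ℝ 𝒳]

/-- Input-to-state stability, uniform in the initial time, of `X' + A X = f(t) X + d` with respect
to bounded disturbances `d`. -/
def InputToStateStable (A : 𝒳 →ₗ.[ℝ] 𝒳) (f : ℝ → 𝒳 →L[ℝ] 𝒳) : Prop :=
  ∃ (b : ℝ → ℝ → ℝ) (γ : ℝ → ℝ), ClassKL b ∧ ClassKInfty γ ∧
    ∀ t₀ : ℝ, 0 ≤ t₀ → ∀ (X₀ : 𝒳), ∀ d ∈ LInfty 𝒳, ∀ X : ℝ → 𝒳,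
      IsMildSolution A f d t₀ X₀ X →
        ∀ t : ℝ, t₀ ≤ t → ‖X t‖ ≤ b ‖X₀‖ (t - t₀) + γ (supNorm d)

/-- Uniform hyperexponential stability of `X' + A X = f(t) X + d` for disturbances `d` in a given
set `D`. For `D = {0}` this is hyperexponential decay of the undisturbed dynamics. -/
def UniformlyHyperexponentiallyStable (A : 𝒳 →ₗ.[ℝ] 𝒳) (f : ℝ → 𝒳 →L[ℝ] 𝒳)
    (D : Set (ℝ → 𝒳)) : Prop :=
  ∃ (κ₀ : ℝ) (ρ κ : ℝ → ℝ) (b : ℝ → ℝ → ℝ),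
    0 ≤ κ₀ ∧ ClassKInfty ρ ∧ ClassKInfty κ ∧ ClassKL b ∧
    ∀ t₀ : ℝ, 0 ≤ t₀ → ∀ (X₀ : 𝒳), ∀ d ∈ D, ∀ X : ℝ → 𝒳,
      IsMildSolution A f d t₀ X₀ X →
        ∀ t : ℝ, t₀ ≤ t →
          ‖X t‖ ≤ Real.exp (-((κ (t - t₀) + κ₀) * (t - t₀))) * ρ ‖X₀‖ + b (supNorm d) (t - t₀)

end Stability

/-! ### Linear maximal monotone operators and Minty's theorem. -/

section MonotoneOperators

variable {𝒳 : Type*} [NormedAddCommGroup 𝒳] [InnerProductSpace ℝ 𝒳]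

/-! The theorem rests on one energy computation. Write `a = ψ^n`. Formally, the derivative of `‖X‖²`
is `-2⟪AX, X⟫ - 2Ka⟪BX, X⟫ + 2⟪X, d⟫`. Monotonicity discards the first term, coercivity bounds the
second by `-2Kβa‖X‖²`, and Young's inequality with weight `a` bounds the third by `a‖X‖² + ‖d‖²/a`.
Thus `(‖X‖²)' ≤ -ηa‖X‖² + ‖d‖²/a`, and Grönwall's lemma gives (2).

A mild solution need not be differentiable, so the computation is done in integrated form.
Contractivity of the semigroup alone yields `‖W b‖² ≤ ‖W a‖² + ∫ 2⟪W, g⟫` for any Duhamel integral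
`W` with forcing `g` (`norm_sq_duhamel_le`): a bound on right slopes for continuous `g`, then
density in `L¹`.

For (1), Minty's theorem gives maximality of the perturbed operators and the resolvents of `A`.
Yosida approximation then gives the semigroup (`MaximalMonotone.exists_semigroup`), and a fixed
point in an exponentially weighted norm gives existence. Uniqueness is the energy estimate with zero
data, once the semigroup is known to be determined by `A`.

Both terms of the estimate can only grow when the gain is replaced by a smaller one, so (3) and (4)
reduce to explicit gains: the constant `ψ(0)^n` for input-to-state stability, and `1 + s` for (4).
Hyperexponential decay in (3) comes from the divergence of the averages of the gain. -/

lemma MonotoneOperator.inner_nonneg {A : 𝒳 →ₗ.[ℝ] 𝒳} (hA : MonotoneOperator A) {x y : 𝒳}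
    (h : (x, y) ∈ A.graph) : 0 ≤ ⟪y, x⟫_ℝ := by
  obtain ⟨z, rfl, rfl⟩ := (LinearPMap.mem_graph_iff A).1 h
  exact hA z

lemma MaximalMonotone.mem_graph {A : 𝒳 →ₗ.[ℝ] 𝒳} (hA : MaximalMonotone A) {u v : 𝒳}
    (h : ∀ x y : 𝒳, (x, y) ∈ A.graph → 0 ≤ ⟪v - y, u - x⟫_ℝ) : (u, v) ∈ A.graph :=
  hA.2 u v fun x => h x (A x) (A.mem_graph x)

/-- By maximality and linearity, the graph is exactly the set of pairs monotonically related to it,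
and each such relation is a closed condition. This makes the graph complete, as the closed range
argument for Minty's theorem needs. -/
lemma MaximalMonotone.isClosed_graph {A : 𝒳 →ₗ.[ℝ] 𝒳} (hA : MaximalMonotone A) :
    IsClosed (A.graph : Set (𝒳 × 𝒳)) := by
  have : (A.graph : Set (𝒳 × 𝒳)) = ⋂ p : A.graph, {q | 0 ≤ ⟪q.2 - p.1.2, q.1 - p.1.1⟫_ℝ} := by
    ext ⟨u, v⟩
    simp only [mem_iInter, mem_ofPred_eq]
    refine ⟨fun h p => ?_, fun h => hA.mem_graph fun x y hxy => h ⟨(x, y), hxy⟩⟩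
    exact hA.1.inner_nonneg (A.graph.sub_mem h p.2)
  rw [this]
  exact isClosed_iInter fun p => isClosed_le (by fun_prop) (by fun_prop)

/-- The domain of a linear maximal monotone operator is dense. -/
lemma MaximalMonotone.dense_domain [CompleteSpace 𝒳] {A : 𝒳 →ₗ.[ℝ] 𝒳} (hA : MaximalMonotone A) :
    Dense (A.domain : Set 𝒳) := by
  rw [Submodule.dense_iff_topologicalClosure_eq_top, Submodule.topologicalClosure_eq_top_iff,
    Submodule.eq_bot_iff]
  intro w hw
  -- For `w` orthogonal to the domain, the pairing of `(0, w)` with `(x, y)` is just `⟪y, x⟫ ≥ 0`.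
  -- Since `A` is linear, `(0, w)` in the graph forces `w = 0`.
  have h0 : ((0 : 𝒳), w) ∈ A.graph := by
    refine hA.mem_graph fun x y hxy => ?_
    have h1 := hA.1.inner_nonneg hxy
    have h2 : ⟪x, w⟫_ℝ = 0 :=
      (Submodule.mem_orthogonal _ _).1 hw x (LinearPMap.mem_domain_of_mem_graph hxy)
    rw [zero_sub, inner_neg_right, inner_sub_left, real_inner_comm, h2]
    linarith
  exact A.graph_fst_eq_zero_snd h0 rfl

/-- A form of Minty's theorem: `I + A + C` is onto for a bounded monotone perturbation `C`. -/
lemma MaximalMonotone.exists_add_eq [CompleteSpace 𝒳] {A : 𝒳 →ₗ.[ℝ] 𝒳} (hA : MaximalMonotone A)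
    (C : 𝒳 →L[ℝ] 𝒳) (hC : ∀ x, 0 ≤ ⟪C x, x⟫_ℝ) (z : 𝒳) :
    ∃ x y : 𝒳, (x, y) ∈ A.graph ∧ x + y + C x = z := by
  -- Viewed on the graph, `I + A + C` is a bounded operator. It is bounded below by monotonicity,
  -- hence has closed range, and it remains to show that the range has trivial orthogonal
  -- complement.
  let L : A.graph →L[ℝ] 𝒳 :=
    ((ContinuousLinearMap.fst ℝ 𝒳 𝒳) + (ContinuousLinearMap.snd ℝ 𝒳 𝒳) +
      C.comp (ContinuousLinearMap.fst ℝ 𝒳 𝒳)).comp A.graph.subtypeL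
  have hL : ∀ p : A.graph, L p = p.1.1 + p.1.2 + C p.1.1 := fun p => rfl
  have hcomp : CompleteSpace A.graph := hA.isClosed_graph.completeSpace_coe
  have hb : ∀ p : A.graph, ‖p.1.1‖ ≤ ‖L p‖ := by
    intro p
    have h1 := hA.1.inner_nonneg p.2
    have h2 : ‖p.1.1‖ ^ 2 ≤ ⟪L p, p.1.1⟫_ℝ := by
      rw [hL, inner_add_left, inner_add_left, real_inner_self_eq_norm_sq]
      linarith [hC p.1.1]
    have h3 := real_inner_le_norm (L p) p.1.1
    by_contra! h
    have h4 : 0 < ‖p.1.1‖ := (norm_nonneg _).trans_lt h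
    nlinarith
  have hanti : AntilipschitzWith (2 + ‖C‖₊) L := by
    refine AddMonoidHomClass.antilipschitz_of_bound L fun p => ?_
    have h1 := hb p
    have h2 : ‖p.1.2‖ ≤ ‖L p‖ + ‖p.1.1‖ + ‖C‖ * ‖p.1.1‖ := by
      have : p.1.2 = L p - p.1.1 - C p.1.1 := by rw [hL]; abel
      calc ‖p.1.2‖ = ‖L p - p.1.1 - C p.1.1‖ := by rw [← this]
        _ ≤ ‖L p‖ + ‖p.1.1‖ + ‖C p.1.1‖ :=
          (norm_sub_le _ _).trans (add_le_add_left (norm_sub_le _ _) _)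
        _ ≤ _ := by gcongr; exact C.le_opNorm _
    have h3 : ‖C‖ * ‖p.1.1‖ ≤ ‖C‖ * ‖L p‖ := by gcongr
    have h4 : 0 ≤ ‖C‖ * ‖L p‖ := by positivity
    have h5 : ‖p‖ = max ‖p.1.1‖ ‖p.1.2‖ := rfl
    rw [h5]
    push_cast
    refine max_le ?_ ?_ <;> nlinarith [norm_nonneg (L p)]
  have hclosed : IsClosed (L.range : Set 𝒳) := by
    rw [LinearMap.coe_range]
    exact hanti.isClosed_range L.uniformContinuous
  have htop : L.range = ⊤ := by
    rw [← hclosed.submodule_topologicalClosure_eq, Submodule.topologicalClosure_eq_top_iff,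
      Submodule.eq_bot_iff]
    intro w hw
    have horth : ∀ x y, (x, y) ∈ A.graph → ⟪w, x⟫_ℝ + ⟪w, y⟫_ℝ + ⟪w, C x⟫_ℝ = 0 := by
      intro x y hxy
      have : ⟪x + y + C x, w⟫_ℝ = 0 :=
        (Submodule.mem_orthogonal _ _).1 hw _ ⟨⟨(x, y), hxy⟩, rfl⟩
      rw [real_inner_comm, inner_add_right, inner_add_right] at this
      exact this
    have hadj : ∀ x, ⟪C.adjoint w, x⟫_ℝ = ⟪w, C x⟫_ℝ := fun x => C.adjoint_inner_left x w
    -- Orthogonality cancels the mixed terms, so the pairing with `(x, y)` is `‖w‖² + ⟪Cw, w⟫ + ⟪y,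
    -- x⟫ ≥ 0`. Orthogonality applied to this new graph element then reads `2‖w‖² + 2⟪Cw, w⟫ = 0`.
    have hmem : (w, w + C.adjoint w) ∈ A.graph := by
      refine hA.mem_graph fun x y hxy => ?_
      have h1 := hA.1.inner_nonneg hxy
      have h2 := horth x y hxy
      have h3 := hC w
      simp only [inner_sub_left, inner_sub_right, inner_add_left, hadj]
      rw [real_inner_comm w y, real_inner_self_eq_norm_sq]
      rw [real_inner_comm] at h3
      nlinarith [sq_nonneg ‖w‖]
    have h1 := horth _ _ hmem
    have h2 := hC w
    rw [inner_add_right, real_inner_self_eq_norm_sq, real_inner_comm, hadj] at h1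
    rw [real_inner_comm] at h2
    have : ‖w‖ ^ 2 = 0 := by nlinarith [sq_nonneg ‖w‖]
    simpa using this
  obtain ⟨p, hp⟩ : z ∈ L.range := by rw [htop]; trivial
  exact ⟨p.1.1, p.1.2, p.2, hp⟩

/-- A monotone operator `P` such that `I + P` is onto is maximal monotone. -/
lemma MonotoneOperator.maximal {P : 𝒳 →ₗ.[ℝ] 𝒳} (hP : MonotoneOperator P)
    (h : ∀ z, ∃ x : P.domain, (x : 𝒳) + P x = z) : MaximalMonotone P := by
  refine ⟨hP, fun u v huv => ?_⟩
  -- This choice of `x` makes `v - P x = -(u - x)`, so the pairing equals `-‖u - x‖²`.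
  obtain ⟨x, hx⟩ := h (u + v)
  have h1 := huv x
  have h2 : v - P x = -(u - x) := by
    rw [neg_sub, sub_eq_sub_iff_add_eq_add, add_comm v u, ← hx]
  rw [h2, inner_neg_left, real_inner_self_eq_norm_sq] at h1
  have h3 : u - x = 0 := by
    have : ‖u - x‖ ^ 2 = 0 := le_antisymm (by linarith) (sq_nonneg _)
    simpa using this
  rw [h3, neg_zero] at h2
  rw [sub_eq_zero.1 h3, sub_eq_zero.1 h2]
  exact P.mem_graph x

/-- The sum of a maximal monotone operator and a bounded monotone operator is maximal monotone. -/
lemma MaximalMonotone.vadd [CompleteSpace 𝒳] {A : 𝒳 →ₗ.[ℝ] 𝒳} (hA : MaximalMonotone A)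
    (C : 𝒳 →L[ℝ] 𝒳) (hC : ∀ x, 0 ≤ ⟪C x, x⟫_ℝ) : MaximalMonotone ((C : 𝒳 →ₗ[ℝ] 𝒳) +ᵥ A) := by
  refine MonotoneOperator.maximal (fun x => ?_) fun z => ?_
  · rw [LinearPMap.vadd_apply, inner_add_left]
    exact add_nonneg (hC _) (hA.1 _)
  · obtain ⟨x, y, hxy, hz⟩ := hA.exists_add_eq C hC z
    obtain ⟨x, rfl, rfl⟩ := (LinearPMap.mem_graph_iff A).1 hxy
    refine ⟨x, ?_⟩
    rw [LinearPMap.vadd_apply, ← hz, add_assoc, add_comm (A x)]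
    rfl

end MonotoneOperators

/-! ### Resolvents and Yosida approximations. -/

section Yosida

variable {𝒳 : Type*} [NormedAddCommGroup 𝒳] [InnerProductSpace ℝ 𝒳]

/-- `J` is the resolvent `(I + A / l)⁻¹`, as a contraction. -/
def IsResolvent (A : 𝒳 →ₗ.[ℝ] 𝒳) (l : ℝ) (J : 𝒳 →L[ℝ] 𝒳) : Prop :=
  (∀ z, (J z, l • (z - J z)) ∈ A.graph) ∧ ∀ z, ‖J z‖ ≤ ‖z‖

/-- The Yosida approximation of `A` with parameter `l`, given the resolvent `J`. -/
def yosida (l : ℝ) (J : 𝒳 →L[ℝ] 𝒳) : 𝒳 →L[ℝ] 𝒳 := l • (ContinuousLinearMap.id ℝ 𝒳 - J)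

@[simp] lemma yosida_apply (l : ℝ) (J : 𝒳 →L[ℝ] 𝒳) (z : 𝒳) : yosida l J z = l • (z - J z) := rfl

/-- The difference `e` of two solutions satisfies `A e = -l e`, so `-l‖e‖² ≥ 0`. Linearity of the
resolvent, commutation of resolvents and `yosida_eq` are all deduced from this uniqueness. -/
lemma MonotoneOperator.resolvent_unique {A : 𝒳 →ₗ.[ℝ] 𝒳} (hA : MonotoneOperator A) {l : ℝ}
    (hl : 0 < l) {x x' z : 𝒳} (h : (x, l • (z - x)) ∈ A.graph) (h' : (x', l • (z - x')) ∈ A.graph) :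
    x = x' := by
  have h1 := hA.inner_nonneg (A.graph.sub_mem h h')
  have h2 : l • (z - x) - l • (z - x') = -(l • (x - x')) := by
    rw [← smul_sub, ← smul_neg]; congr 1; abel
  simp only [h2, inner_neg_left, real_inner_smul_left, real_inner_self_eq_norm_sq] at h1
  have h3 : ‖x - x'‖ ^ 2 = 0 := by nlinarith [sq_nonneg ‖x - x'‖]
  simpa [sub_eq_zero] using h3

lemma MaximalMonotone.exists_isResolvent [CompleteSpace 𝒳] {A : 𝒳 →ₗ.[ℝ] 𝒳}
    (hA : MaximalMonotone A) {l : ℝ} (hl : 1 ≤ l) : ∃ J, IsResolvent A l J := by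
  have h0 : 0 < l := by linarith
  have hex : ∀ z, ∃ x, (x, l • (z - x)) ∈ A.graph := by
    intro z
    -- The operator `l + A` is `I + A + C` with `C = (l - 1) I`, which is monotone because `1 ≤ l`.
    obtain ⟨x, y, hxy, h⟩ := hA.exists_add_eq ((l - 1) • ContinuousLinearMap.id ℝ 𝒳) (fun x => by
      simp only [smul_apply, ContinuousLinearMap.id_apply,
        real_inner_smul_left]
      exact mul_nonneg (by linarith) real_inner_self_nonneg) (l • z)
    refine ⟨x, ?_⟩
    convert hxy using 2
    rw [smul_sub, ← h]
    simp only [smul_apply, ContinuousLinearMap.id_apply]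
    module
  choose J hJ using hex
  have hlin : IsLinearMap ℝ J := by
    refine ⟨fun y z => hA.1.resolvent_unique h0 (hJ _) ?_,
      fun c z => hA.1.resolvent_unique h0 (hJ _) ?_⟩
    · convert A.graph.add_mem (hJ y) (hJ z) using 1
      rw [Prod.mk_add_mk]
      congr 1
      module
    · convert A.graph.smul_mem c (hJ z) using 1
      rw [Prod.smul_mk]
      congr 1
      module
  have hbound : ∀ z, ‖J z‖ ≤ ‖z‖ := by
    intro z
    have h1 := hA.1.inner_nonneg (hJ z)
    rw [real_inner_smul_left, inner_sub_left, real_inner_self_eq_norm_sq] at h1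
    have h2 := nonneg_of_mul_nonneg_right h1 h0
    have h3 := real_inner_le_norm z (J z)
    by_contra! h
    nlinarith [norm_nonneg z]
  exact ⟨(hlin.mk' J).mkContinuous 1 (by simpa using hbound), hJ, hbound⟩

namespace IsResolvent

variable {A : 𝒳 →ₗ.[ℝ] 𝒳} {l m : ℝ} {J J' : 𝒳 →L[ℝ] 𝒳}

lemma inner_yosida_nonneg (hA : MonotoneOperator A) (hl : 0 < l) (hJ : IsResolvent A l J) (z : 𝒳) :
    0 ≤ ⟪yosida l J z, z⟫_ℝ := by
  have h1 := hA.inner_nonneg (hJ.1 z)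
  have h2 : ⟪yosida l J z, z⟫_ℝ = ⟪l • (z - J z), J z⟫_ℝ + l * ‖z - J z‖ ^ 2 := by
    rw [← real_inner_self_eq_norm_sq, ← real_inner_smul_left, ← inner_add_right, yosida_apply]
    simp
  rw [h2]
  positivity

/-- On the domain, the Yosida approximation is the resolvent applied to `A x`. Hence it is bounded
by `‖A x‖` uniformly in `l`, and it converges to `A x` whenever the resolvents converge to the
identity. -/
lemma yosida_eq (hA : MonotoneOperator A) (hl : 0 < l) (hJ : IsResolvent A l J) {x y : 𝒳}
    (h : (x, y) ∈ A.graph) : yosida l J x = J y := by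
  have h1 : J x = x - l⁻¹ • J y := by
    refine hA.resolvent_unique hl (hJ.1 x) ?_
    convert A.graph.sub_mem h (A.graph.smul_mem l⁻¹ (hJ.1 y)) using 1
    rw [Prod.smul_mk, Prod.mk_sub_mk, inv_smul_smul₀ hl.ne', sub_sub_cancel, sub_sub_cancel,
      smul_inv_smul₀ hl.ne']
  rw [yosida_apply, h1, sub_sub_cancel, smul_inv_smul₀ hl.ne']

lemma norm_sub_le (hA : MonotoneOperator A) (hl : 0 < l) (hJ : IsResolvent A l J) {x y : 𝒳}
    (h : (x, y) ∈ A.graph) : ‖x - J x‖ ≤ ‖y‖ / l := by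
  have h1 := hJ.yosida_eq hA hl h
  rw [yosida_apply] at h1
  have h2 := hJ.2 y
  rw [← h1, norm_smul, Real.norm_of_nonneg hl.le] at h2
  rwa [le_div_iff₀' hl]

lemma comm (hA : MonotoneOperator A) (hl : 0 < l) (hm : 0 < m) (hJ : IsResolvent A l J)
    (hJ' : IsResolvent A m J') (z : 𝒳) : J (J' z) = J' (J z) := by
  refine hA.resolvent_unique hm ?_ (hJ'.1 (J z))
  have h1 := hJ.1 (J' z)
  rw [← yosida_apply, hJ.yosida_eq hA hl (hJ'.1 z)] at h1
  simpa using h1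

lemma commute_yosida (hA : MonotoneOperator A) (hl : 0 < l) (hm : 0 < m) (hJ : IsResolvent A l J)
    (hJ' : IsResolvent A m J') : Commute (yosida l J) (yosida m J') := by
  have : Commute J J' := ContinuousLinearMap.ext fun z => hJ.comm hA hl hm hJ' z
  have h1 : Commute (1 - J) (1 - J') :=
    ((Commute.one_left _).sub_left ((Commute.one_right _).sub_right this))
  exact (h1.smul_left l).smul_right m

end IsResolvent

end Yosida

/-! ### Exponentials of bounded monotone operators. -/

section Exponential

open NormedSpace

variable {𝒳 : Type*} [NormedAddCommGroup 𝒳] [InnerProductSpace ℝ 𝒳] [CompleteSpace 𝒳]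

lemma hasDerivAt_exp_smul_apply (T : 𝒳 →L[ℝ] 𝒳) (x : 𝒳) (t : ℝ) :
    HasDerivAt (fun s : ℝ => exp (s • T) x) (T (exp (t • T) x)) t :=
  (hasDerivAt_exp_smul_const' (𝕂 := ℝ) T t).clm_apply (hasDerivAt_const t x) |>.congr_deriv (by simp)

/-- The group generated by `-T`, with `T` bounded and monotone, is contractive in positive time. -/
lemma norm_exp_smul_neg_apply_le (T : 𝒳 →L[ℝ] 𝒳) (hT : ∀ x, 0 ≤ ⟪T x, x⟫_ℝ) {t : ℝ} (ht : 0 ≤ t)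
    (x : 𝒳) : ‖exp (t • -T) x‖ ≤ ‖x‖ := by
  have hd : ∀ s, HasDerivAt (fun s : ℝ => ‖exp (s • -T) x‖ ^ 2)
      (2 * ⟪exp (s • -T) x, (-T) (exp (s • -T) x)⟫_ℝ) s :=
    fun s => (hasDerivAt_exp_smul_apply (-T) x s).norm_sq
  have hanti : Antitone fun s : ℝ => ‖exp (s • -T) x‖ ^ 2 := by
    refine antitone_of_deriv_nonpos (fun s => (hd s).differentiableAt) fun s => ?_
    rw [(hd s).deriv, neg_apply, inner_neg_right, real_inner_comm]
    linarith [hT (exp (s • -T) x)]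
  have h := hanti ht
  simp only [zero_smul, exp_zero, one_apply_eq_self] at h
  exact (pow_le_pow_iff_left₀ (norm_nonneg _) (norm_nonneg _) two_ne_zero).1 h

/-- The path `s ↦ e^{-(t-s)T'} e^{-sT} x` joins the two vectors. Because `T` and `T'` commute, its
derivative is two contractions applied to `T'x - Tx`. -/
lemma norm_exp_smul_neg_sub_le (T T' : 𝒳 →L[ℝ] 𝒳) (hT : ∀ x, 0 ≤ ⟪T x, x⟫_ℝ)
    (hT' : ∀ x, 0 ≤ ⟪T' x, x⟫_ℝ) (hc : Commute T T') {t : ℝ} (ht : 0 ≤ t) (x : 𝒳) :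
    ‖exp (t • -T) x - exp (t • -T') x‖ ≤ t * ‖T x - T' x‖ := by
  have hd : ∀ s, HasDerivAt (fun s : ℝ => exp ((t - s) • -T') (exp (s • -T) x))
      (exp ((t - s) • -T') (exp (s • -T) (T' x - T x))) s := by
    intro s
    have h1 : HasDerivAt (fun s : ℝ => exp ((t - s) • -T')) (-(exp ((t - s) • -T') * -T')) s := by
      exact ((hasDerivAt_exp_smul_const (𝕂 := ℝ) (-T') (t - s)).scomp s
        ((hasDerivAt_id s).const_sub t)).congr_deriv (by simp)
    refine (h1.clm_apply (hasDerivAt_exp_smul_apply (-T) x s)).congr_deriv ?_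
    have hcom : ∀ S : 𝒳 →L[ℝ] 𝒳, Commute T S → ∀ z, exp (s • -T) (S z) = S (exp (s • -T) z) := by
      intro S hS z
      have : Commute (exp (s • -T)) S := ((hS.neg_left.smul_left s).exp_left)
      exact congrArg (fun U : 𝒳 →L[ℝ] 𝒳 => U z) this.eq
    rw [map_sub (exp (s • -T)), hcom T' hc, hcom T (Commute.refl T)]
    simp [sub_eq_add_neg]
  have h := norm_image_sub_le_of_norm_deriv_le_segment' (a := 0) (b := t)
    (fun s _ => (hd s).hasDerivWithinAt) (C := ‖T x - T' x‖) (fun s hs => by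
      rw [norm_sub_rev (T x)]
      exact (norm_exp_smul_neg_apply_le T' hT' (by linarith [hs.2]) _).trans
        (norm_exp_smul_neg_apply_le T hT hs.1 _)) t (right_mem_Icc.2 ht)
  simpa [mul_comm] using h

end Exponential

/-! ### The Hille–Yosida theorem. -/

section Generation

open NormedSpace

variable {𝒳 : Type*} [NormedAddCommGroup 𝒳] [InnerProductSpace ℝ 𝒳]

/-- For uniformly contractive families, uniform convergence on a dense set extends. -/
lemma uniformCauchySeqOn_of_dense {ι : Type*} {s : Set ι} {D : Set 𝒳} (hD : Dense D)
    (F : ℕ → ι → 𝒳 →L[ℝ] 𝒳) (hF : ∀ k, ∀ i ∈ s, ∀ x, ‖F k i x‖ ≤ ‖x‖)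
    (h : ∀ x ∈ D, UniformCauchySeqOn (fun k i => F k i x) atTop s) (x : 𝒳) :
    UniformCauchySeqOn (fun k i => F k i x) atTop s := by
  rw [Metric.uniformCauchySeqOn_iff]
  intro ε hε
  obtain ⟨z, hz, hxz⟩ := hD.exists_dist_lt x (show 0 < ε / 3 by positivity)
  obtain ⟨N, hN⟩ := Metric.uniformCauchySeqOn_iff.1 (h z hz) (ε / 3) (by positivity)
  refine ⟨N, fun m hm n hn i hi => ?_⟩
  have h1 : ∀ k, dist (F k i x) (F k i z) < ε / 3 := fun k => by
    rw [dist_eq_norm, ← map_sub]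
    exact (hF k i hi _).trans_lt (by rwa [← dist_eq_norm])
  have h2 := hN m hm n hn i hi
  have h3 := dist_triangle4 (F m i x) (F m i z) (F n i z) (F n i x)
  have h4 := h1 m
  have h5 := h1 n
  rw [dist_comm] at h5
  linarith

lemma tendsto_resolvent {A : 𝒳 →ₗ.[ℝ] 𝒳} (hA : MonotoneOperator A)
    (hD : Dense (A.domain : Set 𝒳)) {J : ℕ → 𝒳 →L[ℝ] 𝒳}
    (hJ : ∀ k : ℕ, IsResolvent A (k + 1) (J k)) (x : 𝒳) :
    Tendsto (fun k => J k x) atTop (𝓝 x) := by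
  rw [Metric.tendsto_atTop]
  intro ε hε
  obtain ⟨z, hz, hxz⟩ := hD.exists_dist_lt x (show 0 < ε / 3 by positivity)
  obtain ⟨y, hy⟩ := LinearPMap.mem_domain_iff.1 hz
  have h1 : Tendsto (fun k : ℕ => ‖y‖ * (1 / ((k : ℝ) + 1))) atTop (𝓝 0) := by
    simpa using tendsto_one_div_add_atTop_nhds_zero_nat.const_mul ‖y‖
  obtain ⟨N, hN⟩ := (h1.eventually_lt_const (show 0 < ε / 3 by positivity)).exists_forall_of_atTop
  refine ⟨N, fun k hk => ?_⟩
  have h2 : dist (J k z) z < ε / 3 := by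
    rw [dist_comm, dist_eq_norm]
    refine ((hJ k).norm_sub_le hA (by positivity) hy).trans_lt ?_
    have := hN k hk
    rwa [mul_one_div] at this
  have h3 : dist (J k x) (J k z) < ε / 3 := by
    rw [dist_eq_norm, ← map_sub]
    exact ((hJ k).2 _).trans_lt (by rwa [← dist_eq_norm])
  have h4 := dist_triangle4 (J k x) (J k z) z x
  rw [dist_comm] at hxz
  linarith

lemma IsContractionSemigroup.continuous_max {S : ℝ → 𝒳 →L[ℝ] 𝒳} (hS : IsContractionSemigroup S)
    (x : 𝒳) : Continuous fun t => S (max t 0) x :=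
  (hS.continuousOn x).comp_continuous (by fun_prop) fun t => le_max_right t 0

variable [CompleteSpace 𝒳]

/-- The group generated by a bounded monotone operator, in integrated form. -/
lemma sub_exp_smul_neg_apply (T : 𝒳 →L[ℝ] 𝒳) (t : ℝ) (x : 𝒳) :
    x - exp (t • -T) x = ∫ s in (0 : ℝ)..t, exp (s • -T) (T x) := by
  have hcom : ∀ s : ℝ, exp (s • -T) (T x) = T (exp (s • -T) x) := by
    intro s
    have : Commute (exp (s • -T)) T := (((Commute.refl T).neg_left.smul_left s).exp_left)
    exact congrArg (fun U : 𝒳 →L[ℝ] 𝒳 => U x) this.eq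
  have hd : ∀ s, HasDerivAt (fun s : ℝ => -exp (s • -T) x) (exp (s • -T) (T x)) s := fun s =>
    (hasDerivAt_exp_smul_apply (-T) x s).neg.congr_deriv (by rw [hcom]; simp)
  have hcont : Continuous fun s : ℝ => exp (s • -T) (T x) := by
    exact continuous_iff_continuousAt.2 fun s =>
      (hasDerivAt_exp_smul_apply (-T) (T x) s).continuousAt
  rw [intervalIntegral.integral_eq_sub_of_hasDerivAt (fun s _ => hd s)
    (hcont.intervalIntegrable _ _)]
  simp only [zero_smul, exp_zero, one_apply_eq_self]
  abel

/-- The Hille–Yosida theorem in the Hilbert space setting: a linear maximal monotone operator `A`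
gives rise to a contraction semigroup with generator `-A`. -/
theorem MaximalMonotone.exists_semigroup {A : 𝒳 →ₗ.[ℝ] 𝒳} (hA : MaximalMonotone A) :
    ∃ S : ℝ → 𝒳 →L[ℝ] 𝒳, IsContractionSemigroup S ∧ HasGeneratorNeg S A := by
  have hpos : ∀ k : ℕ, (0 : ℝ) < k + 1 := fun k => by positivity
  have hJex : ∀ k : ℕ, ∃ J, IsResolvent A ((k : ℝ) + 1) J := fun k =>
    hA.exists_isResolvent (by linarith [k.cast_nonneg (α := ℝ)])
  choose J hJ using hJex
  set T : ℕ → 𝒳 →L[ℝ] 𝒳 := fun k => yosida ((k : ℝ) + 1) (J k)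
  have hT : ∀ k x, 0 ≤ ⟪T k x, x⟫_ℝ := fun k => (hJ k).inner_yosida_nonneg hA.1 (hpos k)
  have hTy : ∀ {x y}, (x, y) ∈ A.graph → ∀ k, T k x = J k y := fun h k =>
    (hJ k).yosida_eq hA.1 (hpos k) h
  have hcomm : ∀ k j, Commute (T k) (T j) := fun k j =>
    (hJ k).commute_yosida hA.1 (hpos k) (hpos j) (hJ j)
  have hJlim := tendsto_resolvent hA.1 hA.dense_domain hJ
  have hexp : ∀ k (t : ℝ), 0 ≤ t → ∀ x, ‖exp (t • -T k) x‖ ≤ ‖x‖ := fun k _ ht x =>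
    norm_exp_smul_neg_apply_le (T k) (hT k) ht x
  -- For `x` in the domain, `T k x = J k y` is a Cauchy sequence, and the distance between the
  -- exponentials at time `t` is at most `t` times that between these vectors. Density and
  -- contractivity extend this to all `x`.
  have hcauchy : ∀ x b, UniformCauchySeqOn (fun k (t : ℝ) => exp (t • -T k) x) atTop (Icc 0 b) := by
    intro x b
    refine uniformCauchySeqOn_of_dense hA.dense_domain (fun k t => exp (t • -T k))
      (fun k t ht => hexp k t ht.1) (fun x hx => ?_) x
    obtain ⟨y, hy⟩ := LinearPMap.mem_domain_iff.1 hx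
    rw [Metric.uniformCauchySeqOn_iff]
    intro ε hε
    have hb : 0 < |b| + 1 := by positivity
    obtain ⟨N, hN⟩ := Metric.cauchySeq_iff.1 (hJlim y).cauchySeq (ε / (|b| + 1)) (by positivity)
    refine ⟨N, fun m hm n hn t ht => ?_⟩
    have h1 := norm_exp_smul_neg_sub_le (T m) (T n) (hT m) (hT n) (hcomm m n) ht.1 x
    have h2 := hN m hm n hn
    rw [hTy hy, hTy hy, ← dist_eq_norm, ← dist_eq_norm] at h1
    rw [lt_div_iff₀' hb] at h2
    refine h1.trans_lt (lt_of_le_of_lt ?_ h2)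
    gcongr
    linarith [ht.2, le_abs_self b]
  have hlim : ∀ (x : 𝒳) (t : ℝ), ∃ z, Tendsto (fun k => exp (max t 0 • -T k) x) atTop (𝓝 z) :=
    fun x t => cauchySeq_tendsto_of_complete
      ((hcauchy x (max t 0)).cauchySeq ⟨le_max_right _ _, le_rfl⟩)
  choose u hu using hlim
  have hu' : ∀ x t, 0 ≤ t → Tendsto (fun k => exp (t • -T k) x) atTop (𝓝 (u x t)) := by
    intro x t ht
    simpa [max_eq_left ht] using hu x t
  have hunorm : ∀ x t, ‖u x t‖ ≤ ‖x‖ := fun x t =>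
    le_of_tendsto (hu x t).norm (Eventually.of_forall fun k => hexp k _ (le_max_right _ _) x)
  have hlin : ∀ t, IsLinearMap ℝ fun x => u x t := fun t =>
    ⟨fun x y => tendsto_nhds_unique (hu (x + y) t) (by simpa using (hu x t).add (hu y t)),
      fun c x => tendsto_nhds_unique (hu (c • x) t) (by simpa using (hu x t).const_smul c)⟩
  let S : ℝ → 𝒳 →L[ℝ] 𝒳 := fun t =>
    ((hlin t).mk' _).mkContinuous 1 (by simpa using fun x => hunorm x t)
  have hSu : ∀ t x, S t x = u x t := fun t x => rfl
  have hunif : ∀ x b, TendstoUniformlyOn (fun k (t : ℝ) => exp (t • -T k) x) (fun t => S t x)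
      atTop (Icc 0 b) := fun x b =>
    (hcauchy x b).tendstoUniformlyOn_of_tendsto fun t ht => hu' x t ht.1
  have hS : IsContractionSemigroup S := by
    refine ⟨?_, ?_, ?_, fun t _ x => hunorm x t⟩
    · ext x
      refine tendsto_nhds_unique (hu' x 0 le_rfl) ?_
      simp
    · intro s t hs ht
      ext x
      refine tendsto_nhds_unique (hu' x (s + t) (add_nonneg hs ht)) ?_
      have h1 : ∀ k, exp ((s + t) • -T k) x = exp (s • -T k) (exp (t • -T k) x) := by
        intro k
        let _ : NormedAlgebra ℚ (𝒳 →L[ℝ] 𝒳) := .restrictScalars ℚ ℝ _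
        rw [add_smul, exp_add_of_commute (((Commute.refl _).smul_left s).smul_right t)]
        rfl
      simp only [h1]
      have h2 : Tendsto (fun k => exp (s • -T k) (exp (t • -T k) x - u x t)) atTop (𝓝 0) :=
        squeeze_zero_norm (fun k => hexp k s hs _)
          (by simpa using ((hu' x t ht).sub_const (u x t)).norm)
      simpa [hSu] using h2.add (hu' (u x t) s hs)
    · intro x t ht
      have hc : ContinuousOn (fun t => S t x) (Icc 0 (t + 1)) := by
        refine (hunif x (t + 1)).continuousOn (Frequently.of_forall fun k => ?_)
        exact fun s _ => (hasDerivAt_exp_smul_apply (-T k) x s).continuousAt.continuousWithinAt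
      refine (hc t ⟨ht, by linarith⟩).mono_of_mem_nhdsWithin ?_
      rw [← Ici_inter_Iic]
      exact inter_mem_nhdsWithin _ (Iic_mem_nhds (by linarith))
  -- The integrated equation passes to the limit by dominated convergence, and differentiating it at
  -- `0` gives the generator on the domain of `A`.
  have hint : ∀ {x y}, (x, y) ∈ A.graph → ∀ t, 0 ≤ t →
      x - S t x = ∫ s in (0 : ℝ)..t, S (max s 0) y := by
    intro x y hxy t ht
    have h1 := (hu' x t ht).const_sub x
    simp only [sub_exp_smul_neg_apply, hTy hxy] at h1
    refine tendsto_nhds_unique h1 ?_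
    refine intervalIntegral.tendsto_integral_filter_of_dominated_convergence (fun _ => ‖y‖)
      (Eventually.of_forall fun k => ?_) (Eventually.of_forall fun k => ae_of_all _ fun s hs => ?_)
      (by simp) (ae_of_all _ fun s hs => ?_)
    · have : Continuous fun s : ℝ => exp (s • -T k) (J k y) :=
        continuous_iff_continuousAt.2 fun s => (hasDerivAt_exp_smul_apply (-T k) _ s).continuousAt
      exact this.aestronglyMeasurable
    · rw [uIoc_of_le ht] at hs
      exact (hexp k s hs.1.le _).trans ((hJ k).2 y)
    · rw [uIoc_of_le ht] at hs
      rw [max_eq_left hs.1.le]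
      have h2 : Tendsto (fun k => exp (s • -T k) (J k y - y)) atTop (𝓝 0) :=
        squeeze_zero_norm (fun k => hexp k s hs.1.le _)
          (by simpa using ((hJlim y).sub_const y).norm)
      simpa [hSu] using h2.add (hu' y s hs.1.le)
  have hgen : ∀ {x y}, (x, y) ∈ A.graph →
      Tendsto (fun h : ℝ => h⁻¹ • (x - S h x)) (𝓝[>] 0) (𝓝 y) := by
    intro x y hxy
    have hc := hS.continuous_max y
    have h1 : HasDerivAt (fun t => ∫ s in (0 : ℝ)..t, S (max s 0) y) (S (max 0 0) y) 0 :=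
      intervalIntegral.integral_hasDerivAt_right (hc.intervalIntegrable _ _)
        hc.stronglyMeasurable.stronglyMeasurableAtFilter hc.continuousAt
    have h2 := (hasDerivAt_iff_tendsto_slope.1 h1).mono_left
      (nhdsWithin_mono 0 fun t (ht : 0 < t) => ht.ne')
    rw [max_self, hS.zero, ContinuousLinearMap.id_apply] at h2
    refine h2.congr' ?_
    filter_upwards [self_mem_nhdsWithin] with t ht
    rw [slope_def_module, hint hxy t (le_of_lt ht)]
    simp
  -- Conversely, the negative of the generator is monotone by contractivity and extends `A`, so
  -- maximality of `A` shows that it is no larger.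
  refine ⟨S, hS, fun x y => ⟨hgen, fun hxy => hA.mem_graph fun z w hzw => ?_⟩⟩
  have h1 : Tendsto (fun h : ℝ => ⟪h⁻¹ • ((x - z) - S h (x - z)), x - z⟫_ℝ) (𝓝[>] 0)
      (𝓝 ⟪y - w, x - z⟫_ℝ) := by
    refine Tendsto.inner ?_ tendsto_const_nhds
    refine (hxy.sub (hgen hzw)).congr fun h => ?_
    rw [map_sub]
    module
  refine ge_of_tendsto h1 ?_
  filter_upwards [self_mem_nhdsWithin] with h hh
  have h2 : ⟪S h (x - z), x - z⟫_ℝ ≤ ‖x - z‖ * ‖x - z‖ :=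
    (real_inner_le_norm _ _).trans (by gcongr; exact hS.contraction h (le_of_lt hh) _)
  rw [real_inner_smul_left, inner_sub_left, real_inner_self_eq_norm_mul_norm]
  exact mul_nonneg (inv_nonneg.2 (le_of_lt hh)) (by linarith)

end Generation

/-! ### Uniqueness of the semigroup with a given generator. -/

section Uniqueness

variable {𝒳 : Type*} [NormedAddCommGroup 𝒳] [InnerProductSpace ℝ 𝒳]

/-- Joint continuity of a contraction semigroup. -/
lemma IsContractionSemigroup.continuous_uncurry {S : ℝ → 𝒳 →L[ℝ] 𝒳}
    (hS : IsContractionSemigroup S) : Continuous fun p : ℝ × 𝒳 => S (max p.1 0) p.2 := by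
  refine continuous_prod_of_continuous_lipschitzWith' _ 1 (fun t => ?_) fun x =>
    hS.continuous_max x
  refine LipschitzWith.of_dist_le_mul fun x y => ?_
  simp only [dist_eq_norm, NNReal.coe_one, one_mul]
  rw [← map_sub]
  exact hS.contraction _ (le_max_right _ _) _

/-- The semigroup is determined by its generator. -/
theorem HasGeneratorNeg.semigroup_unique {A : 𝒳 →ₗ.[ℝ] 𝒳} (hD : Dense (A.domain : Set 𝒳))
    {S T : ℝ → 𝒳 →L[ℝ] 𝒳} (hS : IsContractionSemigroup S) (hSA : HasGeneratorNeg S A)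
    (hT : IsContractionSemigroup T) (hTA : HasGeneratorNeg T A) {t : ℝ} (ht : 0 ≤ t) :
    S t = T t := by
  refine ContinuousLinearMap.ext fun z => ?_
  refine congrFun ((S t).continuous.ext_on hD (T t).continuous fun x hx => ?_) z
  obtain ⟨y, hy⟩ := LinearPMap.mem_domain_iff.1 hx
  have hinv : ∀ s, 0 ≤ s → (S s x, S s y) ∈ A.graph := by
    intro s hs
    rw [hSA]
    refine (((S s).continuous.tendsto y).comp ((hSA x y).1 hy)).congr' ?_
    filter_upwards [self_mem_nhdsWithin] with h hh
    have : S s (S h x) = S h (S s x) := by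
      have h1 := hS.add s h hs (le_of_lt hh)
      rw [add_comm, hS.add h s (le_of_lt hh) hs] at h1
      exact (congrArg (fun U : 𝒳 →L[ℝ] 𝒳 => U x) h1).symm
    simp [this]
  -- For `x` in the domain, `s ↦ T(t-s) S(s) x` is constant, since its right derivative vanishes.
  -- Its values at `0` and `t` are `T(t) x` and `S(t) x`.
  have hcont : Continuous fun s => T (max (t - s) 0) (S (max s 0) x) :=
    hT.continuous_uncurry.comp ((continuous_const.sub continuous_id).prodMk (hS.continuous_max x))
  have h := constant_of_has_deriv_right_zero (f := fun s => T (max (t - s) 0) (S (max s 0) x))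
    (a := 0) (b := t) hcont.continuousOn ?_ t (right_mem_Icc.2 ht)
  · simpa [hS.zero, hT.zero, ht] using h
  intro s hs
  rw [← hasDerivWithinAt_Ioi_iff_Ici, hasDerivWithinAt_iff_tendsto_slope' (by simp)]
  have h1 : Tendsto (fun h : ℝ => h⁻¹ • (S s x - S h (S s x)) - h⁻¹ • (S s x - T h (S s x)))
      (𝓝[>] 0) (𝓝 0) := by
    have hi := hinv s hs.1
    simpa using ((hSA _ _).1 hi).sub ((hTA _ _).1 hi)
  have h2 : Tendsto (fun r : ℝ => r - s) (𝓝[>] s) (𝓝[>] 0) := by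
    refine tendsto_nhdsWithin_iff.2 ⟨?_, ?_⟩
    · exact ((continuous_id.sub continuous_const).tendsto' s 0 (by simp)).mono_left inf_le_left
    · filter_upwards [self_mem_nhdsWithin] with r hr
      exact sub_pos.2 (mem_Ioi.1 hr)
  refine squeeze_zero_norm' ?_ (tendsto_zero_iff_norm_tendsto_zero.1 (h1.comp h2))
  filter_upwards [self_mem_nhdsWithin, Ioc_mem_nhdsGT hs.2] with r hr hr'
  have hr0 : 0 < r - s := sub_pos.2 (mem_Ioi.1 hr)
  have e1 : S r x = S (r - s) (S s x) := by
    have := hS.add (r - s) s hr0.le hs.1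
    rw [sub_add_cancel] at this
    rw [this]; rfl
  have e2 : ∀ v, T (t - s) v = T (t - r) (T (r - s) v) := by
    intro v
    have := hT.add (t - r) (r - s) (by linarith [hr'.2]) hr0.le
    rw [sub_add_sub_cancel] at this
    rw [this]; rfl
  -- The slope is the contraction `T(t-r)` applied to the quotient of `S(r-s) - T(r-s)` at the fixed
  -- vector `S(s) x`, so continuity of `T` in time is not needed for this limit.
  rw [slope_def_module, max_eq_left (by linarith [hr'.2]), max_eq_left (by linarith [hs.1]),
    max_eq_left (by linarith [hs.2]), max_eq_left hs.1, e1, e2, ← map_sub, ← map_smul]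
  refine (hT.contraction _ (by linarith [hr'.2]) _).trans (le_of_eq ?_)
  rw [Function.comp_apply, ← norm_neg]
  congr 1
  module

end Uniqueness

/-! ### The Duhamel formula and the energy inequality. -/

section Duhamel

variable {𝒳 : Type*} [NormedAddCommGroup 𝒳] [InnerProductSpace ℝ 𝒳]

/-- The right-hand side of the Duhamel formula, with `S` extended by the identity to negative
times. -/
noncomputable def duhamel (S : ℝ → 𝒳 →L[ℝ] 𝒳) (t₀ : ℝ) (X₀ : 𝒳) (g : ℝ → 𝒳) (t : ℝ) : 𝒳 :=
  S (max (t - t₀) 0) X₀ + ∫ s in t₀..t, S (max (t - s) 0) (g s)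

lemma duhamel_self {S : ℝ → 𝒳 →L[ℝ] 𝒳} (hS : IsContractionSemigroup S) (t₀ : ℝ) (X₀ : 𝒳)
    (g : ℝ → 𝒳) : duhamel S t₀ X₀ g t₀ = X₀ := by
  simp [duhamel, hS.zero]

lemma duhamel_eq (S : ℝ → 𝒳 →L[ℝ] 𝒳) {t₀ t : ℝ} (ht : t₀ ≤ t) (X₀ : 𝒳) (g : ℝ → 𝒳) :
    duhamel S t₀ X₀ g t = S (t - t₀) X₀ + ∫ s in t₀..t, S (t - s) (g s) := by
  rw [duhamel, max_eq_left (sub_nonneg.2 ht)]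
  congr 1
  refine intervalIntegral.integral_congr fun s hs => ?_
  rw [uIcc_of_le ht] at hs
  simp only [max_eq_left (sub_nonneg.2 hs.2)]

namespace IsContractionSemigroup

variable {S : ℝ → 𝒳 →L[ℝ] 𝒳} {g h : ℝ → 𝒳} {t₀ a b t : ℝ} {X₀ : 𝒳}

lemma norm_max_le (hS : IsContractionSemigroup S) (t : ℝ) (x : 𝒳) : ‖S (max t 0) x‖ ≤ ‖x‖ :=
  hS.contraction _ (le_max_right _ _) x

lemma aestronglyMeasurable {μ : Measure ℝ} (hS : IsContractionSemigroup S)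
    (hg : AEStronglyMeasurable g μ) (t : ℝ) :
    AEStronglyMeasurable (fun s => S (max (t - s) 0) (g s)) μ := by
  have h1 : Continuous fun p : ℝ × 𝒳 => S (max (t - p.1) 0) p.2 :=
    hS.continuous_uncurry.comp ((continuous_const.sub continuous_fst).prodMk continuous_snd)
  exact h1.comp_aestronglyMeasurable (aestronglyMeasurable_id.prodMk hg)

lemma intervalIntegrable (hS : IsContractionSemigroup S) (hg : IntervalIntegrable g volume a b)
    (t : ℝ) : IntervalIntegrable (fun s => S (max (t - s) 0) (g s)) volume a b :=
  hg.mono_fun (hS.aestronglyMeasurable hg.def'.aestronglyMeasurable t)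
    (ae_of_all _ fun _ => hS.norm_max_le _ _)

lemma norm_integral_le (hS : IsContractionSemigroup S) (hab : a ≤ b)
    (hg : IntervalIntegrable g volume a b) (t : ℝ) :
    ‖∫ s in a..b, S (max (t - s) 0) (g s)‖ ≤ ∫ s in a..b, ‖g s‖ :=
  intervalIntegral.norm_integral_le_of_norm_le hab (ae_of_all _ fun _ _ => hS.norm_max_le _ _)
    hg.norm

lemma norm_duhamel_le (hS : IsContractionSemigroup S) (ht : t₀ ≤ t)
    (hg : IntervalIntegrable g volume t₀ t) :
    ‖duhamel S t₀ X₀ g t‖ ≤ ‖X₀‖ + ∫ s in t₀..t, ‖g s‖ :=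
  (norm_add_le _ _).trans (add_le_add (hS.norm_max_le _ _) (hS.norm_integral_le ht hg t))

lemma norm_duhamel_sub_le (hS : IsContractionSemigroup S) (ht : t₀ ≤ t)
    (hg : IntervalIntegrable g volume t₀ t) (hh : IntervalIntegrable h volume t₀ t) :
    ‖duhamel S t₀ X₀ g t - duhamel S t₀ X₀ h t‖ ≤ ∫ s in t₀..t, ‖g s - h s‖ := by
  have : duhamel S t₀ X₀ g t - duhamel S t₀ X₀ h t =
      ∫ s in t₀..t, S (max (t - s) 0) (g s - h s) := by
    simp only [duhamel, map_sub]
    rw [intervalIntegral.integral_sub (hS.intervalIntegrable hg t) (hS.intervalIntegrable hh t)]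
    abel
  rw [this]
  exact hS.norm_integral_le ht (hg.sub hh) t

lemma continuous_duhamel [CompleteSpace 𝒳] (hS : IsContractionSemigroup S)
    (hg : ∀ a b, IntervalIntegrable g volume a b) :
    Continuous (duhamel S t₀ X₀ g) := by
  refine ((hS.continuous_max X₀).comp (continuous_id.sub continuous_const)).add ?_
  refine continuous_iff_continuousAt.2 fun t => ?_
  -- The time variable occurs both in the upper limit and in the integrand. The two occurrences are
  -- separated, and continuity is restricted to the diagonal.
  have h1 : ContinuousAt (fun p : ℝ × ℝ => ∫ s in t₀..p.2, S (max (p.1 - s) 0) (g s)) (t, t) := by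
    refine intervalIntegral.continuousAt_parametric_primitive_of_dominated
      (F := fun x s => S (max (x - s) 0) (g s)) (fun s => ‖g s‖)
      (min t₀ t - 1) (max t₀ t + 1) (fun x => ?_) (Eventually.of_forall fun x => ?_)
      (hg _ _).norm (ae_of_all _ fun s => ?_) ⟨?_, ?_⟩ ⟨?_, ?_⟩ (by simp)
    · exact hS.aestronglyMeasurable (hg _ _).def'.aestronglyMeasurable x
    · exact ae_of_all _ fun s => hS.norm_max_le _ _
    · exact ((hS.continuous_max (g s)).comp (continuous_id.sub continuous_const)).continuousAt
    · linarith [min_le_left t₀ t]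
    · linarith [le_max_left t₀ t]
    · linarith [min_le_right t₀ t]
    · linarith [le_max_right t₀ t]
  exact h1.comp (f := fun t : ℝ => (t, t)) (by fun_prop)

/-- The Duhamel formula can be restarted at an intermediate time. -/
lemma duhamel_restart [CompleteSpace 𝒳] (hS : IsContractionSemigroup S) (ha : t₀ ≤ a) (hb : a ≤ b)
    (hg : IntervalIntegrable g volume t₀ b) :
    duhamel S t₀ X₀ g b = duhamel S a (duhamel S t₀ X₀ g a) g b := by
  have hga : IntervalIntegrable g volume t₀ a := hg.mono_set (by
    rw [uIcc_of_le ha, uIcc_of_le (ha.trans hb)]; exact Icc_subset_Icc_right hb)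
  have hgb : IntervalIntegrable g volume a b := hg.mono_set (by
    rw [uIcc_of_le hb, uIcc_of_le (ha.trans hb)]; exact Icc_subset_Icc_left ha)
  have hcomp : ∀ s, s ≤ a → ∀ x, S (max (b - s) 0) x = S (max (b - a) 0) (S (max (a - s) 0) x) := by
    intro s hs x
    rw [max_eq_left (by linarith), max_eq_left (by linarith), max_eq_left (by linarith),
      ← sub_add_sub_cancel b a s, hS.add _ _ (by linarith) (by linarith)]
    rfl
  have h1 : ∫ s in t₀..a, S (max (b - s) 0) (g s) =
      S (max (b - a) 0) (∫ s in t₀..a, S (max (a - s) 0) (g s)) := by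
    rw [← ContinuousLinearMap.intervalIntegral_comp_comm _ (hS.intervalIntegrable hga a)]
    refine intervalIntegral.integral_congr fun s hs => ?_
    rw [uIcc_of_le ha] at hs
    exact hcomp s hs.2 _
  rw [duhamel, ← intervalIntegral.integral_add_adjacent_intervals
    (hS.intervalIntegrable hga b) (hS.intervalIntegrable hgb b), h1, hcomp t₀ ha]
  simp only [duhamel, map_add]
  abel

/-- The energy inequality for continuous data. -/
lemma norm_sq_duhamel_le_of_continuous [CompleteSpace 𝒳] (hS : IsContractionSemigroup S)
    (hg : Continuous g) (ht : t₀ ≤ t) :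
    ‖duhamel S t₀ X₀ g t‖ ^ 2 ≤
      ‖X₀‖ ^ 2 + ∫ s in t₀..t, 2 * ⟪duhamel S t₀ X₀ g s, g s⟫_ℝ := by
  have hgi : ∀ a b, IntervalIntegrable g volume a b := fun a b => hg.intervalIntegrable a b
  set W := duhamel S t₀ X₀ g with hW
  have hWc : Continuous W := hS.continuous_duhamel hgi
  have hic : Continuous fun s => 2 * ⟪W s, g s⟫_ℝ := continuous_const.mul (hWc.inner hg)
  refine image_le_of_liminf_slope_right_le_deriv_boundary (f := fun s => ‖W s‖ ^ 2)
    (B := fun t => ‖X₀‖ ^ 2 + ∫ s in t₀..t, 2 * ⟪W s, g s⟫_ℝ)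
    (B' := fun s => 2 * ⟪W s, g s⟫_ℝ) (a := t₀) (b := t) (by fun_prop) ?_ ?_ ?_ ?_
    (right_mem_Icc.2 ht)
  · simp [hW, duhamel_self hS]
  · exact (continuous_const.add (intervalIntegral.continuous_primitive
      (fun a b => hic.intervalIntegrable a b) t₀)).continuousOn
  · intro s _
    exact ((hic.integral_hasStrictDerivAt t₀ s).hasDerivAt.const_add _).hasDerivWithinAt
  · intro s hs r hr
    have hKc : Continuous fun p : ℝ × ℝ => S (max (p.1 - p.2) 0) (g p.2) :=
      hS.continuous_uncurry.comp ((continuous_fst.sub continuous_snd).prodMk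
        (hg.comp continuous_snd))
    -- the increment of the forcing term
    have hI : Tendsto (fun z => (z - s)⁻¹ • ∫ τ in s..z, S (max (z - τ) 0) (g τ)) (𝓝[>] s)
        (𝓝 (g s)) := by
      rw [Metric.tendsto_nhds]
      intro ε hε
      have h1 : ∀ᶠ p : ℝ × ℝ in 𝓝 (s, s), dist (S (max (p.1 - p.2) 0) (g p.2)) (g s) < ε / 2 := by
        have := hKc.tendsto (s, s)
        simp only [sub_self, max_self, hS.zero, ContinuousLinearMap.id_apply] at this
        exact Metric.tendsto_nhds.1 this _ (by positivity)
      obtain ⟨δ, hδ, h2⟩ := Metric.eventually_nhds_iff.1 h1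
      filter_upwards [Ioo_mem_nhdsGT (show s < s + δ by linarith)] with z hz
      have hzs : 0 < z - s := by linarith [hz.1]
      have h3 : (∫ τ in s..z, S (max (z - τ) 0) (g τ)) - (z - s) • g s =
          ∫ τ in s..z, (S (max (z - τ) 0) (g τ) - g s) := by
        rw [intervalIntegral.integral_sub (hS.intervalIntegrable (hgi _ _) z) (by simp)]
        simp
      have h4 : ‖∫ τ in s..z, (S (max (z - τ) 0) (g τ) - g s)‖ ≤ ε / 2 * |z - s| := by
        refine intervalIntegral.norm_integral_le_of_norm_le_const fun τ hτ => ?_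
        rw [uIoc_of_le hz.1.le] at hτ
        rw [← dist_eq_norm]
        refine (h2 (y := (z, τ)) ?_).le
        rw [Prod.dist_eq, max_lt_iff, Real.dist_eq, Real.dist_eq, abs_of_pos hzs,
          abs_of_pos (by linarith [hτ.1])]
        exact ⟨by linarith [hz.2], by linarith [hz.2, hτ.2]⟩
      rw [abs_of_pos hzs] at h4
      have h5 : (z - s)⁻¹ • (∫ τ in s..z, S (max (z - τ) 0) (g τ)) - g s =
          (z - s)⁻¹ • ((∫ τ in s..z, S (max (z - τ) 0) (g τ)) - (z - s) • g s) := by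
        rw [smul_sub, inv_smul_smul₀ hzs.ne']
      rw [dist_eq_norm, h5, h3, norm_smul, Real.norm_of_nonneg (inv_nonneg.2 hzs.le),
        inv_mul_lt_iff₀ hzs]
      nlinarith
    -- After restarting at `s`, `W z = S(z-s) W s + v`. Expanding the square and using `‖S(z-s) W s‖
    -- ≤ ‖W s‖` bounds the slope of `‖W‖²` by this expression.
    have hlim : Tendsto (fun z =>
        2 * ⟪S (max (z - s) 0) (W s), (z - s)⁻¹ • ∫ τ in s..z, S (max (z - τ) 0) (g τ)⟫_ℝ +
          (z - s) * ‖(z - s)⁻¹ • ∫ τ in s..z, S (max (z - τ) 0) (g τ)‖ ^ 2) (𝓝[>] s)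
        (𝓝 (2 * ⟪W s, g s⟫_ℝ + 0 * ‖g s‖ ^ 2)) := by
      have h1 : Tendsto (fun z => S (max (z - s) 0) (W s)) (𝓝[>] s) (𝓝 (W s)) := by
        refine Tendsto.mono_left ?_ (inf_le_left : 𝓝[>] s ≤ 𝓝 s)
        exact ((hS.continuous_max (W s)).comp (continuous_id.sub continuous_const)).tendsto' s _
          (by simp [hS.zero])
      have h2 : Tendsto (fun z => z - s) (𝓝[>] s) (𝓝 0) :=
        ((continuous_id.sub continuous_const).tendsto' s 0 (by simp)).mono_left inf_le_left
      exact ((h1.inner hI).const_mul 2).add (h2.mul (hI.norm.pow 2))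
    rw [zero_mul, add_zero] at hlim
    refine Eventually.frequently ?_
    filter_upwards [hlim.eventually_lt_const hr, self_mem_nhdsWithin] with z hz hsz
    have hzs : 0 < z - s := sub_pos.2 (mem_Ioi.1 hsz)
    refine lt_of_le_of_lt ?_ hz
    have h1 : W z = S (max (z - s) 0) (W s) + ∫ τ in s..z, S (max (z - τ) 0) (g τ) :=
      hS.duhamel_restart hs.1 (le_of_lt hsz) (hgi _ _)
    set v := ∫ τ in s..z, S (max (z - τ) 0) (g τ)
    have h2 : ‖S (max (z - s) 0) (W s)‖ ^ 2 ≤ ‖W s‖ ^ 2 := by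
      gcongr; exact hS.norm_max_le _ _
    rw [slope_def_field, h1, norm_add_sq_real, real_inner_smul_right, norm_smul,
      Real.norm_of_nonneg (inv_nonneg.2 hzs.le), div_le_iff₀ hzs]
    have h3 : (2 * ((z - s)⁻¹ * ⟪S (max (z - s) 0) (W s), v⟫_ℝ) +
        (z - s) * ((z - s)⁻¹ * ‖v‖) ^ 2) * (z - s) =
        2 * ⟪S (max (z - s) 0) (W s), v⟫_ℝ + ‖v‖ ^ 2 := by
      field_simp
    rw [h3]
    linarith

/-- The energy inequality for globally integrable data. -/
lemma norm_sq_duhamel_le_of_integrable [CompleteSpace 𝒳] (hS : IsContractionSemigroup S)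
    (hg : Integrable g) (ht : t₀ ≤ t) :
    ‖duhamel S t₀ X₀ g t‖ ^ 2 ≤
      ‖X₀‖ ^ 2 + ∫ s in t₀..t, 2 * ⟪duhamel S t₀ X₀ g s, g s⟫_ℝ := by
  choose h hh using fun k : ℕ => hg.exists_hasCompactSupport_integral_sub_le
    (show (0 : ℝ) < 1 / ((k : ℝ) + 1) by positivity)
  have he : Tendsto (fun k : ℕ => 1 / ((k : ℝ) + 1)) atTop (𝓝 0) :=
    tendsto_one_div_add_atTop_nhds_zero_nat
  have hle : ∀ {f : ℝ → 𝒳}, Integrable f → ∀ {r}, t₀ ≤ r →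
      ∫ s in t₀..r, ‖f s‖ ≤ ∫ s, ‖f s‖ := by
    intro f hf r hr
    rw [intervalIntegral.integral_of_le hr]
    exact setIntegral_le_integral hf.norm (ae_of_all _ fun _ => norm_nonneg _)
  have hclose : ∀ k r, t₀ ≤ r →
      ‖duhamel S t₀ X₀ (h k) r - duhamel S t₀ X₀ g r‖ ≤ 1 / ((k : ℝ) + 1) := by
    intro k r hr
    rw [norm_sub_rev]
    exact (hS.norm_duhamel_sub_le hr hg.intervalIntegrable (hh k).2.2.2.intervalIntegrable).trans
      ((hle (hg.sub (hh k).2.2.2) hr).trans (hh k).2.1)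
  have hWc : Continuous (duhamel S t₀ X₀ g) := hS.continuous_duhamel fun _ _ => hg.intervalIntegrable
  have hkc : ∀ k, Continuous (duhamel S t₀ X₀ (h k)) := fun k =>
    hS.continuous_duhamel fun _ _ => (hh k).2.2.2.intervalIntegrable
  have hM : ∀ r, t₀ ≤ r → ‖duhamel S t₀ X₀ g r‖ ≤ ‖X₀‖ + ∫ s, ‖g s‖ := fun r hr =>
    (hS.norm_duhamel_le hr hg.intervalIntegrable).trans (by gcongr; exact hle hg hr)
  have hint : ∀ {V f : ℝ → 𝒳}, Continuous V → Integrable f →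
      IntervalIntegrable (fun s => 2 * ⟪V s, f s⟫_ℝ) volume t₀ t := by
    intro V f hV hf
    obtain ⟨M, hM⟩ := isCompact_uIcc.exists_bound_of_continuousOn (hV.continuousOn (s := uIcc t₀ t))
    refine ((hf.intervalIntegrable (a := t₀) (b := t)).norm.const_mul (2 * M)).mono_fun'
      ((hV.aestronglyMeasurable.inner hf.aestronglyMeasurable.restrict).const_mul 2) ?_
    filter_upwards [ae_restrict_mem measurableSet_uIoc] with s hs
    have h1 := hM s (uIoc_subset_uIcc hs)
    have h2 := abs_real_inner_le_norm (V s) (f s)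
    rw [norm_mul, Real.norm_eq_abs, Real.norm_eq_abs, abs_two]
    nlinarith [norm_nonneg (f s)]
  have hlim : Tendsto (fun k => ∫ s in t₀..t, 2 * ⟪duhamel S t₀ X₀ (h k) s, h k s⟫_ℝ) atTop
      (𝓝 (∫ s in t₀..t, 2 * ⟪duhamel S t₀ X₀ g s, g s⟫_ℝ)) := by
    rw [tendsto_iff_norm_sub_tendsto_zero]
    have h0 : Tendsto (fun k : ℕ => 2 * (1 / ((k : ℝ) + 1) * (1 / ((k : ℝ) + 1)) +
        1 / ((k : ℝ) + 1) * (∫ s, ‖g s‖) + (‖X₀‖ + ∫ s, ‖g s‖) * (1 / ((k : ℝ) + 1)))) atTop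
        (𝓝 0) := by
      have := (((he.mul he).add (he.mul_const (∫ s, ‖g s‖))).add
        (he.const_mul (‖X₀‖ + ∫ s, ‖g s‖))).const_mul 2
      simpa using this
    refine squeeze_zero (fun _ => norm_nonneg _) (fun k => ?_) h0
    have hd := hg.sub (hh k).2.2.2
    rw [← intervalIntegral.integral_sub (hint (hkc k) (hh k).2.2.2) (hint hWc hg)]
    set e := 1 / ((k : ℝ) + 1)
    have he0 : 0 ≤ e := by positivity
    have hM0 : 0 ≤ ‖X₀‖ + ∫ s, ‖g s‖ := by positivity
    have hb : IntervalIntegrable (fun s => 2 * (e * ‖g s - h k s‖ + e * ‖g s‖ +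
        (‖X₀‖ + ∫ s, ‖g s‖) * ‖g s - h k s‖)) volume t₀ t :=
      ((((hd.norm.const_mul e).add (hg.norm.const_mul e)).add
        (hd.norm.const_mul _)).const_mul 2).intervalIntegrable
    refine (intervalIntegral.norm_integral_le_of_norm_le ht (ae_of_all _ fun s hs => ?_) hb).trans ?_
    · have e1 : 2 * ⟪duhamel S t₀ X₀ (h k) s, h k s⟫_ℝ - 2 * ⟪duhamel S t₀ X₀ g s, g s⟫_ℝ =
          2 * (-⟪duhamel S t₀ X₀ (h k) s - duhamel S t₀ X₀ g s, g s - h k s⟫_ℝ +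
            ⟪duhamel S t₀ X₀ (h k) s - duhamel S t₀ X₀ g s, g s⟫_ℝ -
            ⟪duhamel S t₀ X₀ g s, g s - h k s⟫_ℝ) := by
        simp only [inner_sub_left, inner_sub_right]
        ring
      have hc := hclose k s hs.1.le
      have hm := hM s hs.1.le
      rw [e1, norm_mul, Real.norm_eq_abs, Real.norm_eq_abs, abs_two]
      refine mul_le_mul_of_nonneg_left ?_ (by norm_num)
      refine (abs_sub _ _).trans (add_le_add ((abs_add_le _ _).trans (add_le_add ?_ ?_)) ?_)
      · rw [abs_neg]
        exact (abs_real_inner_le_norm _ _).trans (by gcongr)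
      · exact (abs_real_inner_le_norm _ _).trans (by gcongr)
      · exact (abs_real_inner_le_norm _ _).trans (by gcongr)
    · have i1 : IntervalIntegrable (fun s => ‖g s - h k s‖) volume t₀ t :=
        hd.norm.intervalIntegrable
      have i2 : IntervalIntegrable (fun s => ‖g s‖) volume t₀ t := hg.norm.intervalIntegrable
      rw [intervalIntegral.integral_const_mul, intervalIntegral.integral_add
        ((i1.const_mul _).add (i2.const_mul _)) (i1.const_mul _), intervalIntegral.integral_add
        (i1.const_mul _) (i2.const_mul _), intervalIntegral.integral_const_mul,
        intervalIntegral.integral_const_mul, intervalIntegral.integral_const_mul]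
      have j1 : ∫ s in t₀..t, ‖g s - h k s‖ ≤ e := (hle hd ht).trans (hh k).2.1
      have j2 := hle hg ht
      gcongr
  have hptw : Tendsto (fun k => duhamel S t₀ X₀ (h k) t) atTop (𝓝 (duhamel S t₀ X₀ g t)) := by
    rw [tendsto_iff_norm_sub_tendsto_zero]
    exact squeeze_zero (fun _ => norm_nonneg _) (fun k => hclose k t ht) he
  exact le_of_tendsto_of_tendsto' (hptw.norm.pow 2) (hlim.const_add _) fun k =>
    hS.norm_sq_duhamel_le_of_continuous (hh k).2.2.1 ht

lemma duhamel_congr (ht : t₀ ≤ t) (hgh : EqOn g h (Ioc t₀ t)) :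
    duhamel S t₀ X₀ g t = duhamel S t₀ X₀ h t := by
  rw [duhamel, duhamel]
  congr 1
  refine intervalIntegral.integral_congr_ae (ae_of_all _ fun s hs => ?_)
  rw [uIoc_of_le ht] at hs
  simp only [hgh hs]

/-- The energy inequality. -/
theorem norm_sq_duhamel_le [CompleteSpace 𝒳] (hS : IsContractionSemigroup S) (ha : t₀ ≤ a)
    (hb : a ≤ b) (hg : IntervalIntegrable g volume t₀ b) :
    ‖duhamel S t₀ X₀ g b‖ ^ 2 ≤
      ‖duhamel S t₀ X₀ g a‖ ^ 2 + ∫ s in a..b, 2 * ⟪duhamel S t₀ X₀ g s, g s⟫_ℝ := by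
  -- Truncation outside `(t₀, b]` gives globally integrable data without changing the solution on
  -- `[a, b]`, and restarting at `a` moves the initial time there.
  have hgi : Integrable ((Ioc t₀ b).indicator g) :=
    (integrable_indicator_iff measurableSet_Ioc).2
      ((intervalIntegrable_iff_integrableOn_Ioc_of_le (ha.trans hb)).1 hg)
  have hgab : EqOn ((Ioc t₀ b).indicator g) g (Ioc t₀ b) := fun s hs => indicator_of_mem hs g
  have h1 := hS.norm_sq_duhamel_le_of_integrable (X₀ := duhamel S t₀ X₀ g a) hgi hb
  have h2 : ∀ s, a ≤ s → s ≤ b →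
      duhamel S a (duhamel S t₀ X₀ g a) ((Ioc t₀ b).indicator g) s = duhamel S t₀ X₀ g s := by
    intro s has hsb
    rw [duhamel_congr has (hgab.mono (Ioc_subset_Ioc ha hsb)),
      ← hS.duhamel_restart ha has (hg.mono_set ?_)]
    rw [uIcc_of_le (ha.trans has), uIcc_of_le (ha.trans hb)]
    exact Icc_subset_Icc_right hsb
  rw [h2 b hb le_rfl] at h1
  refine h1.trans (le_of_eq ?_)
  congr 1
  refine intervalIntegral.integral_congr_ae (ae_of_all _ fun s hs => ?_)
  rw [uIoc_of_le hb] at hs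
  simp only [h2 s hs.1.le hs.2, hgab (Ioc_subset_Ioc_left ha hs)]

end IsContractionSemigroup

end Duhamel

/-! ### Grönwall's lemma in integral form. -/

section Gronwall

/-- A function with `u r ≤ u s - ∫_s^r p u`, `p ≥ 0`, stays nonpositive. -/
lemma nonpos_of_le_sub_integral {u p : ℝ → ℝ} {a b : ℝ} (hab : a ≤ b)
    (hu : ContinuousOn u (Icc a b)) (hp : ∀ s, 0 ≤ p s) (ha : u a ≤ 0)
    (h : ∀ s, a ≤ s → s ≤ b → u b ≤ u s - ∫ r in s..b, p r * u r) : u b ≤ 0 := by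
  by_contra! hb
  have hK : IsCompact (Icc a b ∩ u ⁻¹' Iic 0) :=
    isCompact_Icc.of_isClosed_subset (hu.preimage_isClosed_of_isClosed isClosed_Icc isClosed_Iic)
      inter_subset_left
  -- Here `σ` is the last time with `u ≤ 0`. After it the integrand is nonnegative, so the
  -- inequality from `σ` to `b` contradicts `u b > 0`.
  obtain ⟨σ, ⟨hσ, hσ0⟩, hmax⟩ := hK.exists_isGreatest ⟨a, left_mem_Icc.2 hab, ha⟩
  have hpos : ∀ r ∈ Icc σ b, 0 ≤ p r * u r ∨ r = σ := by
    intro r hr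
    rcases hr.1.eq_or_lt with h1 | h1
    · exact Or.inr h1.symm
    · left
      refine mul_nonneg (hp r) ?_
      by_contra! h2
      exact h1.not_ge (hmax ⟨⟨hσ.1.trans hr.1, hr.2⟩, h2.le⟩)
  have h2 : 0 ≤ ∫ r in σ..b, p r * u r := by
    refine intervalIntegral.integral_nonneg_of_ae_restrict hσ.2 ?_
    filter_upwards [ae_restrict_mem measurableSet_Icc,
      ae_restrict_of_ae (volume.ae_ne σ)] with r hr hne
    exact (hpos r hr).resolve_right hne
  have h3 := h σ hσ.1 hσ.2
  have h4 : u σ ≤ 0 := hσ0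
  linarith

/-- A Grönwall lemma for the integral inequality `y r ≤ y s + ∫_s^r (q - p y)`. -/
lemma le_of_le_add_integral {y p q : ℝ → ℝ} {a b : ℝ} (hab : a ≤ b)
    (hy : ContinuousOn y (Icc a b)) (hp : Continuous p) (hp0 : ∀ s, 0 ≤ p s) (hq : Continuous q)
    (h : ∀ s, a ≤ s → s ≤ b → y b ≤ y s + ∫ r in s..b, (q r - p r * y r)) :
    y b ≤ Real.exp (-∫ r in a..b, p r) * y a +
      ∫ s in a..b, Real.exp (-∫ r in s..b, p r) * q s := by
  set P : ℝ → ℝ := fun t => ∫ r in a..t, p r with hP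
  have hPd : ∀ t, HasDerivAt P (p t) t := fun t => (hp.integral_hasStrictDerivAt a t).hasDerivAt
  have hPc : Continuous P := continuous_iff_continuousAt.2 fun t => (hPd t).continuousAt
  have hec : Continuous fun s => Real.exp (P s) * q s := by fun_prop
  set Q : ℝ → ℝ := fun t => ∫ s in a..t, Real.exp (P s) * q s with hQ
  have hQd : ∀ t, HasDerivAt Q (Real.exp (P t) * q t) t := fun t =>
    (hec.integral_hasStrictDerivAt a t).hasDerivAt
  have hQc : Continuous Q := continuous_iff_continuousAt.2 fun t => (hQd t).continuousAt
  -- By variation of constants, `v` solves `v' = q - p v` with `v a = y a`, so `y - v` satisfies the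
  -- homogeneous inequality.
  set v : ℝ → ℝ := fun t => Real.exp (-P t) * (y a + Q t) with hv
  have hvd : ∀ t, HasDerivAt v (q t - p t * v t) t := by
    intro t
    refine ((hPd t).neg.exp.mul ((hQd t).const_add (y a))).congr_deriv ?_
    have : Real.exp (-P t) * Real.exp (P t) = 1 := by rw [← Real.exp_add]; simp
    simp only [hv]
    linear_combination q t * this
  have hvc : Continuous v := by fun_prop
  have hvi : Continuous fun t => q t - p t * v t := by fun_prop
  have hmain : y b - v b ≤ 0 := by
    refine nonpos_of_le_sub_integral (u := fun t => y t - v t) (p := p) hab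
      (hy.sub hvc.continuousOn) hp0 (by simp [hv, hP, hQ]) fun s has hsb => ?_
    have hys : ContinuousOn y (uIcc s b) := by
      rw [uIcc_of_le hsb]; exact hy.mono (Icc_subset_Icc_left has)
    have h1 : ∫ r in s..b, (q r - p r * v r) = v b - v s :=
      intervalIntegral.integral_eq_sub_of_hasDerivAt (fun t _ => hvd t)
        (hvi.intervalIntegrable _ _)
    have hyi : IntervalIntegrable (fun r => q r - p r * y r) volume s b :=
      (hq.continuousOn.sub (hp.continuousOn.mul hys)).intervalIntegrable
    have h2 : ∫ r in s..b, p r * (y r - v r) =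
        (∫ r in s..b, (q r - p r * v r)) - ∫ r in s..b, (q r - p r * y r) := by
      rw [← intervalIntegral.integral_sub (hvi.intervalIntegrable _ _) hyi]
      congr 1
      ext r
      ring
    rw [h2, h1]
    linarith [h s has hsb]
  have h3 : v b = Real.exp (-∫ r in a..b, p r) * y a +
      ∫ s in a..b, Real.exp (-∫ r in s..b, p r) * q s := by
    simp only [hv, mul_add, hQ]
    congr 1
    rw [← intervalIntegral.integral_const_mul]
    congr 1
    ext s
    have : P b = P s + ∫ r in s..b, p r := (intervalIntegral.integral_add_adjacent_intervals
      (hp.intervalIntegrable _ _) (hp.intervalIntegrable _ _)).symm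
    rw [← mul_assoc, ← Real.exp_add, this]
    congr 2
    ring
  linarith

end Gronwall

/-! ### The energy estimate for the closed loop. -/

section Estimate

variable {𝒳 : Type*} [NormedAddCommGroup 𝒳] [InnerProductSpace ℝ 𝒳]

lemma ContinuousOn.intervalIntegrable_inner {V g : ℝ → 𝒳} {a b : ℝ}
    (hV : ContinuousOn V (uIcc a b)) (hg : IntervalIntegrable g volume a b) :
    IntervalIntegrable (fun s => ⟪V s, g s⟫_ℝ) volume a b := by
  obtain ⟨M, hM⟩ := isCompact_uIcc.exists_bound_of_continuousOn hV
  refine (hg.norm.const_mul M).mono_fun' (AEStronglyMeasurable.inner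
    ((hV.aestronglyMeasurable_of_isCompact isCompact_uIcc measurableSet_uIcc).mono_set
      uIoc_subset_uIcc) hg.def'.aestronglyMeasurable) ?_
  filter_upwards [ae_restrict_mem measurableSet_uIoc] with s hs
  exact (norm_inner_le_norm _ _).trans (by gcongr; exact hM s (uIoc_subset_uIcc hs))

/-- The dissipation inequality behind the choice of the gain. -/
lemma CoerciveWith.two_mul_inner_le {B : 𝒳 →L[ℝ] 𝒳} {K β a D : ℝ} (hB : CoerciveWith B β)
    (hK : 0 ≤ K) (ha : 0 < a) {x d : 𝒳} (hd : ‖d‖ ≤ D) :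
    2 * ⟪x, (-((K * a) • B)) x + d⟫_ℝ ≤ D ^ 2 / a - (2 * K * β - 1) * a * ‖x‖ ^ 2 := by
  have h1 := mul_le_mul_of_nonneg_left (hB.2 x) (mul_nonneg hK ha.le)
  have h2 : ⟪x, d⟫_ℝ ≤ ‖x‖ * D := (real_inner_le_norm _ _).trans (by gcongr)
  -- Young's inequality weighted by the gain: its cost `a‖x‖²` is the `-1` in `2Kβ - 1`.
  have h3 : 0 ≤ (a * ‖x‖ - D) ^ 2 / a := by positivity
  have h4 : (a * ‖x‖ - D) ^ 2 / a = a * ‖x‖ ^ 2 - 2 * (‖x‖ * D) + D ^ 2 / a := by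
    field_simp
    ring
  rw [inner_add_right, neg_apply, smul_apply, inner_neg_right, real_inner_smul_right,
    real_inner_comm]
  linarith

/-- The energy estimate for solutions of the Duhamel formula of the closed-loop system. -/
theorem IsContractionSemigroup.norm_sq_le [CompleteSpace 𝒳] {S : ℝ → 𝒳 →L[ℝ] 𝒳}
    (hS : IsContractionSemigroup S) {B : 𝒳 →L[ℝ] 𝒳} {K β : ℝ} (hB : CoerciveWith B β)
    (hKβ : 1 / 2 < K * β) {a : ℝ → ℝ} (ha : Continuous a) (ha0 : ∀ s, 0 < a s) {t₀ D : ℝ}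
    {X₀ : 𝒳} {d X : ℝ → 𝒳} (hd : ∀ᵐ s, t₀ ≤ s → ‖d s‖ ≤ D) (hX : ContinuousOn X (Ici t₀))
    (hi : ∀ t, t₀ ≤ t →
      IntervalIntegrable (fun s => (-((K * a s) • B)) (X s) + d s) volume t₀ t)
    (hm : ∀ t, t₀ ≤ t → X t = duhamel S t₀ X₀ (fun s => (-((K * a s) • B)) (X s) + d s) t)
    {t : ℝ} (ht : t₀ ≤ t) :
    ‖X t‖ ^ 2 ≤ Real.exp (-((2 * K * β - 1) * ∫ r in t₀..t, a r)) * ‖X₀‖ ^ 2 +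
      (∫ s in t₀..t, Real.exp (-((2 * K * β - 1) * ∫ r in s..t, a r)) / a s) * D ^ 2 := by
  have hK : 0 ≤ K := by
    by_contra! h
    nlinarith [hB.1]
  have hη : 0 < 2 * K * β - 1 := by linarith
  have hX0 : X t₀ = X₀ := by rw [hm t₀ le_rfl, duhamel_self hS]
  have hqc : Continuous fun s => D ^ 2 / a s := continuous_const.div ha fun s => (ha0 s).ne'
  have hXs : ContinuousOn X (Icc t₀ t) := hX.mono Icc_subset_Ici_self
  have h := le_of_le_add_integral (y := fun s => ‖X s‖ ^ 2) (p := fun s => (2 * K * β - 1) * a s)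
    (q := fun s => D ^ 2 / a s) ht (hXs.norm.pow 2) (by fun_prop)
    (fun s => by have := ha0 s; positivity) hqc fun s hs hst => ?_
  · simp only [intervalIntegral.integral_const_mul, hX0] at h
    refine h.trans (le_of_eq ?_)
    congr 1
    rw [← intervalIntegral.integral_mul_const]
    congr 1
    ext s
    ring
  · have hXst : ContinuousOn X (uIcc s t) := by
      rw [uIcc_of_le hst]; exact hXs.mono (Icc_subset_Icc_left hs)
    have hist : IntervalIntegrable (fun s => (-((K * a s) • B)) (X s) + d s) volume s t :=
      (hi t ht).mono_set (by
        rw [uIcc_of_le hst, uIcc_of_le ht]; exact Icc_subset_Icc_left hs)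
    have h1 := hS.norm_sq_duhamel_le (X₀ := X₀) hs hst (hi t ht)
    rw [← hm t ht, ← hm s hs] at h1
    refine h1.trans ?_
    have h2 : ∫ r in s..t, 2 * ⟪duhamel S t₀ X₀ (fun s => (-((K * a s) • B)) (X s) + d s) r,
        (-((K * a r) • B)) (X r) + d r⟫_ℝ =
        ∫ r in s..t, 2 * ⟪X r, (-((K * a r) • B)) (X r) + d r⟫_ℝ := by
      refine intervalIntegral.integral_congr fun r hr => ?_
      rw [uIcc_of_le hst] at hr
      simp only [← hm r (hs.trans hr.1)]
    rw [h2]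
    gcongr
    refine intervalIntegral.integral_mono_ae_restrict hst
      ((hXst.intervalIntegrable_inner hist).const_mul 2)
      (hqc.continuousOn.sub ((by fun_prop : Continuous fun s => (2 * K * β - 1) * a s).continuousOn.mul
        (hXst.norm.pow 2))).intervalIntegrable ?_
    filter_upwards [ae_restrict_mem measurableSet_Icc, ae_restrict_of_ae hd] with r hr hdr
    exact hB.two_mul_inner_le hK (ha0 r) (hdr (hs.trans hr.1))

end Estimate

/-! ### Existence by a weighted fixed point. -/

section Existence

variable {𝒳 : Type*} [NormedAddCommGroup 𝒳] [InnerProductSpace ℝ 𝒳]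

lemma IsContractionSemigroup.duhamel_add {S : ℝ → 𝒳 →L[ℝ] 𝒳} (hS : IsContractionSemigroup S)
    {t₀ t : ℝ} {X₀ Y₀ : 𝒳} {g h : ℝ → 𝒳} (hg : IntervalIntegrable g volume t₀ t)
    (hh : IntervalIntegrable h volume t₀ t) :
    duhamel S t₀ X₀ g t + duhamel S t₀ Y₀ h t =
      duhamel S t₀ (X₀ + Y₀) (fun s => g s + h s) t := by
  simp only [duhamel, map_add]
  rw [intervalIntegral.integral_add (hS.intervalIntegrable hg t) (hS.intervalIntegrable hh t)]
  abel

/-- Existence of global solutions of the Duhamel formula for a time-varying bounded perturbation,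
by contraction in an exponentially weighted space of bounded continuous functions. -/
theorem IsContractionSemigroup.exists_duhamel_eq [CompleteSpace 𝒳] {S : ℝ → 𝒳 →L[ℝ] 𝒳}
    (hS : IsContractionSemigroup S) {f : ℝ → 𝒳 →L[ℝ] 𝒳} (hf : Continuous f) {d : ℝ → 𝒳} {D : ℝ}
    (hd : ∀ a b, IntervalIntegrable d volume a b) (hD : ∀ᵐ s, ‖d s‖ ≤ D) (t₀ : ℝ) (X₀ : 𝒳) :
    ∃ X : ℝ → 𝒳, Continuous X ∧
      ∀ t, t₀ ≤ t → X t = duhamel S t₀ X₀ (fun s => f s (X s) + d s) t := by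
  have hcc : Continuous fun s => 2 * ‖f s‖ + 1 := by fun_prop
  -- In the unknown `Y = e^{-w} X`, the term `2‖f‖` in `w'` yields the contraction constant `1/2`.
  -- The extra `1` gives `w t ≥ t - t₀`, so the weight absorbs the linear growth due to `d`.
  set w : ℝ → ℝ := fun t => ∫ s in t₀..t, (2 * ‖f s‖ + 1) with hw
  have hwd : ∀ t, HasDerivAt w (2 * ‖f t‖ + 1) t := fun t =>
    (hcc.integral_hasStrictDerivAt t₀ t).hasDerivAt
  have hwc : Continuous w := continuous_iff_continuousAt.2 fun t => (hwd t).continuousAt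
  have hw0 : w t₀ = 0 := by simp [hw]
  have hwge : ∀ t, t₀ ≤ t → t - t₀ ≤ w t := by
    intro t ht
    have : ∫ _ in t₀..t, (1 : ℝ) ≤ w t :=
      intervalIntegral.integral_mono_on ht (by simp) (hcc.intervalIntegrable _ _)
        fun s _ => by linarith [norm_nonneg (f s)]
    simpa using this
  have hwint : ∀ t, t₀ ≤ t → ∫ s in t₀..t, Real.exp (w s) * ‖f s‖ ≤ Real.exp (w t) / 2 := by
    intro t ht
    have h1 : ∫ s in t₀..t, Real.exp (w s) * (2 * ‖f s‖ + 1) = Real.exp (w t) - Real.exp (w t₀) :=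
      intervalIntegral.integral_eq_sub_of_hasDerivAt (fun s _ => (hwd s).exp)
        (Continuous.intervalIntegrable (by fun_prop) _ _)
    have h2 : ∫ s in t₀..t, 2 * (Real.exp (w s) * ‖f s‖) ≤
        ∫ s in t₀..t, Real.exp (w s) * (2 * ‖f s‖ + 1) :=
      intervalIntegral.integral_mono_on ht (Continuous.intervalIntegrable (by fun_prop) _ _)
        (Continuous.intervalIntegrable (by fun_prop) _ _)
        fun s _ => by linarith [Real.exp_pos (w s)]
    rw [intervalIntegral.integral_const_mul, h1, hw0, Real.exp_zero] at h2
    linarith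
  let G : (BoundedContinuousFunction ℝ 𝒳) → ℝ → 𝒳 := fun Y s => Real.exp (w s) • f s (Y s)
  have hGc : ∀ Y, Continuous (G Y) := fun Y =>
    (Real.continuous_exp.comp hwc).smul (hf.clm_apply Y.continuous)
  have hGi : ∀ Y a b, IntervalIntegrable (G Y) volume a b := fun Y a b =>
    (hGc Y).intervalIntegrable a b
  have hGsub : ∀ Y Z t, t₀ ≤ t → ∫ s in t₀..t, ‖G Y s - G Z s‖ ≤ Real.exp (w t) / 2 * ‖Y - Z‖ := by
    intro Y Z t ht
    have h1 : ∫ s in t₀..t, ‖G Y s - G Z s‖ ≤ ∫ s in t₀..t, Real.exp (w s) * ‖f s‖ * ‖Y - Z‖ := by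
      refine intervalIntegral.integral_mono_on ht
        (((hGc Y).sub (hGc Z)).norm.intervalIntegrable _ _)
        (Continuous.intervalIntegrable (by fun_prop) _ _) fun s _ => ?_
      have e : G Y s - G Z s = Real.exp (w s) • f s ((Y - Z) s) := by
        simp [G, smul_sub]
      rw [e, norm_smul, Real.norm_of_nonneg (Real.exp_pos _).le, mul_assoc]
      gcongr
      exact (f s).le_opNorm_of_le ((Y - Z).norm_coe_le_norm s)
    rw [intervalIntegral.integral_mul_const] at h1
    exact h1.trans (by gcongr; exact hwint t ht)
  let Ψ : (BoundedContinuousFunction ℝ 𝒳) → ℝ → 𝒳 := fun Y t =>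
    Real.exp (-w t) • (duhamel S t₀ X₀ d t + duhamel S t₀ 0 (G Y) t)
  have hΨc : ∀ Y, Continuous (Ψ Y) := fun Y =>
    (Real.continuous_exp.comp hwc.neg).smul
      ((hS.continuous_duhamel hd).add (hS.continuous_duhamel (hGi Y)))
  have hexp : ∀ t, Real.exp (-w t) * Real.exp (w t) = 1 := fun t => by rw [← Real.exp_add]; simp
  have hDn : 0 ≤ D := by
    obtain ⟨s, hs⟩ := hD.exists
    exact (norm_nonneg _).trans hs
  have hΨb : ∀ Y t, t₀ ≤ t → ‖Ψ Y t‖ ≤ ‖X₀‖ + D + ‖Y‖ := by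
    intro Y t ht
    have h1 : ‖duhamel S t₀ X₀ d t‖ ≤ ‖X₀‖ + D * (t - t₀) := by
      refine (hS.norm_duhamel_le ht (hd _ _)).trans ?_
      gcongr
      have : ∫ s in t₀..t, ‖d s‖ ≤ ∫ _ in t₀..t, D :=
        intervalIntegral.integral_mono_ae ht (hd _ _).norm (by simp) hD
      simpa [mul_comm] using this
    have h2 : ‖duhamel S t₀ 0 (G Y) t‖ ≤ Real.exp (w t) / 2 * ‖Y‖ := by
      refine (hS.norm_duhamel_le ht (hGi Y _ _)).trans ?_
      have := hGsub Y 0 t ht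
      simpa [G] using this
    have h3 : ‖X₀‖ + D * (t - t₀) ≤ Real.exp (w t) * (‖X₀‖ + D) := by
      have e1 := Real.add_one_le_exp (w t)
      have e2 := hwge t ht
      have e3 : 1 ≤ Real.exp (w t) := by linarith
      have e4 : t - t₀ ≤ Real.exp (w t) := by linarith
      nlinarith [norm_nonneg X₀]
    rw [norm_smul, Real.norm_of_nonneg (Real.exp_pos _).le]
    calc _ ≤ Real.exp (-w t) * (Real.exp (w t) * (‖X₀‖ + D) + Real.exp (w t) / 2 * ‖Y‖) := by
          gcongr
          exact (norm_add_le _ _).trans (add_le_add (h1.trans h3) h2)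
      _ = (Real.exp (-w t) * Real.exp (w t)) * (‖X₀‖ + D + ‖Y‖ / 2) := by ring
      _ ≤ _ := by rw [hexp]; linarith [norm_nonneg Y]
  let Φ : (BoundedContinuousFunction ℝ 𝒳) → (BoundedContinuousFunction ℝ 𝒳) := fun Y =>
    BoundedContinuousFunction.ofNormedAddCommGroup (fun t => Ψ Y (max t t₀))
      ((hΨc Y).comp (by fun_prop)) (‖X₀‖ + D + ‖Y‖) fun t => hΨb Y _ (le_max_right _ _)
  have hΦ : ContractingWith (1 / 2) Φ := by
    refine ⟨by norm_num, LipschitzWith.of_dist_le_mul fun Y Z => ?_⟩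
    refine (BoundedContinuousFunction.dist_le (by positivity)).2 fun t => ?_
    set τ := max t t₀
    have hτ : t₀ ≤ τ := le_max_right _ _
    have h1 : Ψ Y τ - Ψ Z τ =
        Real.exp (-w τ) • (duhamel S t₀ 0 (G Y) τ - duhamel S t₀ 0 (G Z) τ) := by
      simp only [Ψ, ← smul_sub]
      congr 1
      abel
    have h2 := (hS.norm_duhamel_sub_le (X₀ := 0) hτ (hGi Y _ _) (hGi Z _ _)).trans (hGsub Y Z τ hτ)
    change dist (Ψ Y τ) (Ψ Z τ) ≤ _
    rw [dist_eq_norm, dist_eq_norm, h1, norm_smul, Real.norm_of_nonneg (Real.exp_pos _).le]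
    calc _ ≤ Real.exp (-w τ) * (Real.exp (w τ) / 2 * ‖Y - Z‖) := by gcongr
      _ = (Real.exp (-w τ) * Real.exp (w τ)) * (1 / 2 * ‖Y - Z‖) := by ring
      _ = _ := by rw [hexp]; simp
  set Y := hΦ.fixedPoint
  have hfix : ∀ t, t₀ ≤ t → Y t = Ψ Y t := by
    intro t ht
    have h1 : Φ Y = Y := hΦ.fixedPoint_isFixedPt
    calc Y t = Φ Y t := by rw [h1]
      _ = Ψ Y (max t t₀) := rfl
      _ = Ψ Y t := by rw [max_eq_left ht]
  refine ⟨fun t => Real.exp (w t) • Y t, (Real.continuous_exp.comp hwc).smul Y.continuous,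
    fun t ht => ?_⟩
  have hG : (fun s => f s (Real.exp (w s) • Y s) + d s) = fun s => G Y s + d s := by
    ext s
    simp [G]
  rw [hG]
  simp only [hfix t ht, Ψ]
  rw [smul_smul, mul_comm, hexp, one_smul, add_comm, hS.duhamel_add (hGi Y _ _) (hd _ _), zero_add]

end Existence

/-! ### Well-posedness and energy estimate for mild solutions. -/

section MildSolutions

/-- Nothing is known about `ψ` at negative times. Freezing it at `ψ 0` there gives a gain that is
continuous and positive on the whole line. -/
lemma continuous_gain {ψ : ℝ → ℝ} {n : ℝ} (hψ : ContinuousOn ψ (Ici 0)) (hψ0 : ∀ t, 0 ≤ t → 0 < ψ t) :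
    Continuous fun s => ψ (max s 0) ^ n :=
  (hψ.comp_continuous (by fun_prop) fun s => le_max_right s 0).rpow_const
    fun s => Or.inl (hψ0 _ (le_max_right s 0)).ne'

lemma gain_pos {ψ : ℝ → ℝ} {n : ℝ} (hψ0 : ∀ t, 0 ≤ t → 0 < ψ t) (s : ℝ) : 0 < ψ (max s 0) ^ n :=
  Real.rpow_pos_of_pos (hψ0 _ (le_max_right s 0)) n

variable {𝒳 : Type*} [NormedAddCommGroup 𝒳]

lemma supNorm_nonneg (d : ℝ → 𝒳) : 0 ≤ supNorm d := ENNReal.toReal_nonneg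

lemma supNorm_zero : supNorm (0 : ℝ → 𝒳) = 0 := by simp [supNorm]

lemma ae_norm_le_supNorm {d : ℝ → 𝒳} (hd : d ∈ LInfty 𝒳) : ∀ᵐ s, 0 ≤ s → ‖d s‖ ≤ supNorm d := by
  have hd' : MemLp d ∞ (volume.restrict (Ici (0 : ℝ))) := hd
  have h1 := ae_le_eLpNormEssSup (f := d) (μ := volume.restrict (Ici (0 : ℝ)))
  refine (ae_imp_of_ae_restrict h1).mono fun s hs h0 => ?_
  have h2 := hs h0
  rw [← eLpNorm_exponent_top] at h2
  simpa [supNorm] using ENNReal.toReal_mono hd'.2.ne h2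

lemma ae_norm_indicator_le_supNorm {d : ℝ → 𝒳} (hd : d ∈ LInfty 𝒳) :
    ∀ᵐ s, ‖(Ici (0 : ℝ)).indicator d s‖ ≤ supNorm d := by
  filter_upwards [ae_norm_le_supNorm hd] with s hs
  by_cases h : 0 ≤ s
  · rw [indicator_of_mem (mem_Ici.2 h)]; exact hs h
  · rw [indicator_of_notMem (by simpa using h), norm_zero]; exact supNorm_nonneg d

lemma intervalIntegrable_indicator_of_mem_LInfty {d : ℝ → 𝒳} (hd : d ∈ LInfty 𝒳) (a b : ℝ) :
    IntervalIntegrable ((Ici (0 : ℝ)).indicator d) volume a b := by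
  have hd' : MemLp d ∞ (volume.restrict (Ici (0 : ℝ))) := hd
  have hm : AEStronglyMeasurable ((Ici (0 : ℝ)).indicator d) volume :=
    (aestronglyMeasurable_indicator_iff measurableSet_Ici).2 hd'.1
  exact (intervalIntegrable_const (c := supNorm d)).mono_fun' hm.restrict
    (ae_restrict_of_ae (ae_norm_indicator_le_supNorm hd))

variable [InnerProductSpace ℝ 𝒳]

lemma IsMildSolution.exists_duhamel {A : 𝒳 →ₗ.[ℝ] 𝒳} {f : ℝ → 𝒳 →L[ℝ] 𝒳} {d : ℝ → 𝒳} {t₀ : ℝ}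
    {X₀ : 𝒳} {X : ℝ → 𝒳} (h : IsMildSolution A f d t₀ X₀ X) :
    ∃ S : ℝ → 𝒳 →L[ℝ] 𝒳, IsContractionSemigroup S ∧ HasGeneratorNeg S A ∧
      ∀ t, t₀ ≤ t → IntervalIntegrable (fun s => f s (X s) + d s) volume t₀ t ∧
        X t = duhamel S t₀ X₀ (fun s => f s (X s) + d s) t := by
  obtain ⟨S, hS, hSA, -, h⟩ := h
  exact ⟨S, hS, hSA, fun t ht => ⟨(h t ht).1, by rw [duhamel_eq S ht]; exact (h t ht).2⟩⟩

lemma feedback_eq {B : 𝒳 →L[ℝ] 𝒳} {K n s : ℝ} {ψ : ℝ → ℝ} (hs : 0 ≤ s) :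
    feedback K n ψ B s = -((K * ψ (max s 0) ^ n) • B) := by
  rw [feedback, max_eq_left hs]

variable [CompleteSpace 𝒳] {A : 𝒳 →ₗ.[ℝ] 𝒳} {B : 𝒳 →L[ℝ] 𝒳} {K β n : ℝ} {ψ : ℝ → ℝ}
  {d : ℝ → 𝒳} {t₀ : ℝ} {X₀ : 𝒳}

theorem MaximalMonotone.exists_mildSolution (hA : MaximalMonotone A)
    (hψ : ContinuousOn ψ (Ici 0)) (hψ0 : ∀ t, 0 ≤ t → 0 < ψ t) (ht₀ : 0 ≤ t₀) (X₀ : 𝒳)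
    (hd : d ∈ LInfty 𝒳) : ∃ X : ℝ → 𝒳, IsMildSolution A (feedback K n ψ B) d t₀ X₀ X := by
  obtain ⟨S, hS, hSA⟩ := hA.exists_semigroup
  have hac := continuous_gain (n := n) hψ hψ0
  have hfc : Continuous fun s => -((K * ψ (max s 0) ^ n) • B) :=
    ((continuous_const.mul hac).smul continuous_const).neg
  obtain ⟨X, hX, h⟩ := hS.exists_duhamel_eq hfc (intervalIntegrable_indicator_of_mem_LInfty hd)
    (ae_norm_indicator_le_supNorm hd) t₀ X₀
  have heq : ∀ t, EqOn (fun s => (-((K * ψ (max s 0) ^ n) • B)) (X s) + (Ici (0 : ℝ)).indicator d s)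
      (fun s => feedback K n ψ B s (X s) + d s) (Ioc t₀ t) := by
    intro t s hs
    have h0 : 0 ≤ s := ht₀.trans hs.1.le
    simp only [feedback_eq h0, indicator_of_mem (mem_Ici.2 h0)]
  refine ⟨X, S, hS, hSA, hX.continuousOn, fun t ht => ⟨?_, ?_⟩⟩
  · refine IntervalIntegrable.congr ?_ (((hfc.clm_apply hX).intervalIntegrable t₀ t).add
      (intervalIntegrable_indicator_of_mem_LInfty hd t₀ t))
    rw [uIoc_of_le ht]
    exact heq t
  · rw [← duhamel_eq S ht, h t ht]
    exact IsContractionSemigroup.duhamel_congr ht (heq t)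

/-- The energy estimate for mild solutions, in terms of the continuous extension of the gain. -/
theorem IsMildSolution.norm_sq_le {X : ℝ → 𝒳} (hX : IsMildSolution A (feedback K n ψ B) d t₀ X₀ X)
    (hB : CoerciveWith B β) (hKβ : 1 / 2 < K * β)
    (hψ : ContinuousOn ψ (Ici 0)) (hψ0 : ∀ t, 0 ≤ t → 0 < ψ t) (ht₀ : 0 ≤ t₀)
    (hd : d ∈ LInfty 𝒳) {t : ℝ} (ht : t₀ ≤ t) :
    ‖X t‖ ^ 2 ≤
      Real.exp (-((2 * K * β - 1) * ∫ r in t₀..t, ψ (max r 0) ^ n)) * ‖X₀‖ ^ 2 +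
      (∫ s in t₀..t, Real.exp (-((2 * K * β - 1) * ∫ r in s..t, ψ (max r 0) ^ n)) /
        ψ (max s 0) ^ n) * supNorm d ^ 2 := by
  obtain ⟨S, hS, -, h⟩ := hX.exists_duhamel
  obtain ⟨-, -, -, hXc, -⟩ := hX
  have heq : ∀ t, EqOn (fun s => feedback K n ψ B s (X s) + d s)
      (fun s => (-((K * ψ (max s 0) ^ n) • B)) (X s) + d s) (Ioc t₀ t) := by
    intro t s hs
    simp only [feedback_eq (ht₀.trans hs.1.le)]
  refine hS.norm_sq_le hB hKβ (continuous_gain hψ hψ0) (gain_pos hψ0)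
    ((ae_norm_le_supNorm hd).mono fun s hs h0 => hs (ht₀.trans h0)) hXc
    (fun r hr => (h r hr).1.congr ?_) (fun r hr => ?_) ht
  · rw [uIoc_of_le hr]
    exact heq r
  · rw [(h r hr).2]
    exact IsContractionSemigroup.duhamel_congr hr (heq r)

theorem IsMildSolution.eqOn {X Y : ℝ → 𝒳} (hA : MaximalMonotone A)
    (hX : IsMildSolution A (feedback K n ψ B) d t₀ X₀ X)
    (hY : IsMildSolution A (feedback K n ψ B) d t₀ X₀ Y)
    (hB : CoerciveWith B β) (hKβ : 1 / 2 < K * β)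
    (hψ : ContinuousOn ψ (Ici 0)) (hψ0 : ∀ t, 0 ≤ t → 0 < ψ t) (ht₀ : 0 ≤ t₀) :
    EqOn X Y (Ici t₀) := by
  obtain ⟨S, hS, hSA, h⟩ := hX.exists_duhamel
  obtain ⟨T, hT, hTA, h'⟩ := hY.exists_duhamel
  obtain ⟨-, -, -, hXc, -⟩ := hX
  obtain ⟨-, -, -, hYc, -⟩ := hY
  -- Each mild solution carries its own semigroup. They agree because both have generator `-A`, so
  -- the difference of the solutions is a mild solution with zero data.
  have hST : duhamel T = duhamel (𝒳 := 𝒳) S := by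
    have : ∀ t, T (max t 0) = S (max t 0) := fun t =>
      hTA.semigroup_unique hA.dense_domain hT hS hSA (le_max_right t 0)
    simp only [duhamel, funext_iff, this, implies_true]
  rw [hST] at h'
  set F : ℝ → 𝒳 := fun s => (feedback K n ψ B s (X s) + d s) - (feedback K n ψ B s (Y s) + d s)
  have hFi : ∀ t, t₀ ≤ t → IntervalIntegrable F volume t₀ t := fun t ht => (h t ht).1.sub (h' t ht).1
  have hZ : ∀ t, t₀ ≤ t → X t - Y t = duhamel S t₀ 0 F t := by
    intro t ht
    rw [(h t ht).2, (h' t ht).2, sub_eq_iff_eq_add, hS.duhamel_add (hFi t ht) (h' t ht).1, zero_add]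
    congr 1
    ext s
    exact (sub_add_cancel _ _).symm
  have hZm : IsMildSolution A (feedback K n ψ B) 0 t₀ 0 (fun t => X t - Y t) := by
    have hF : (fun s => feedback K n ψ B s (X s - Y s) + (0 : ℝ → 𝒳) s) = F := by
      ext s
      simp [F]
    refine ⟨S, hS, hSA, hXc.sub hYc, fun t ht => ?_⟩
    rw [← duhamel_eq S ht]
    exact ⟨by rw [← hF] at hFi; exact hFi t ht,
      (hZ t ht).trans (congrArg (fun g => duhamel S t₀ 0 g t) hF.symm)⟩
  intro t ht
  have h0 : (0 : ℝ → 𝒳) ∈ LInfty 𝒳 := MemLp.zero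
  have := hZm.norm_sq_le hB hKβ hψ hψ0 ht₀ h0 ht
  rw [supNorm_zero, norm_zero] at this
  have h2 : ‖X t - Y t‖ ^ 2 = 0 := le_antisymm (by simpa using this) (sq_nonneg _)
  simpa [sub_eq_zero] using h2

end MildSolutions

/-! ### Comparison functions. -/

section ComparisonFunctions

lemma classKInfty_const_mul {c : ℝ} (hc : 0 < c) : ClassKInfty fun r => c * r :=
  ⟨⟨by fun_prop, by simp, fun _ _ _ _ h => mul_lt_mul_of_pos_left h hc⟩,
    tendsto_id.const_mul_atTop hc⟩

lemma classKInfty_id : ClassKInfty fun r => r := by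
  simpa using classKInfty_const_mul one_pos

lemma classKL_mul {k : ℝ → ℝ} (hk : ContinuousOn k (Ici 0)) (hpos : ∀ t, 0 ≤ t → 0 < k t)
    (hanti : StrictAntiOn k (Ici 0)) (hlim : Tendsto k atTop (𝓝 0)) :
    ClassKL fun r t => r * k t := by
  refine ⟨continuousOn_fst.mul (hk.comp continuousOn_snd fun p hp => hp.2), fun t ht =>
    ⟨by fun_prop, by simp, fun _ _ _ _ h => mul_lt_mul_of_pos_right h (hpos t ht)⟩,
    fun r hr => ⟨fun s hs t ht h => mul_lt_mul_of_pos_left (hanti hs ht h) hr, ?_⟩⟩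
  simpa using hlim.const_mul r

lemma classKL_mul_exp {c : ℝ} (hc : 0 < c) : ClassKL fun r t => r * Real.exp (-(c * t)) := by
  refine classKL_mul (by fun_prop) (fun t _ => Real.exp_pos _) (fun s _ t _ h => ?_) ?_
  · exact Real.exp_lt_exp.2 (neg_lt_neg (mul_lt_mul_of_pos_left h hc))
  · exact Real.tendsto_exp_neg_atTop_nhds_zero.comp (tendsto_id.const_mul_atTop hc)

lemma classKL_mul_div {c : ℝ} (hc : 0 < c) : ClassKL fun r t => r * (c / (1 + t)) := by
  refine classKL_mul ?_ (fun t _ => by positivity) (fun s hs t _ h => ?_) ?_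
  · exact continuousOn_const.div (by fun_prop) fun t ht => by
      have : 0 ≤ t := ht
      positivity
  · have : 0 ≤ s := hs
    exact div_lt_div_of_pos_left hc (by positivity) (by linarith)
  · exact tendsto_const_nhds.div_atTop (tendsto_atTop_add_const_left _ 1 tendsto_id)

/-- The rate function of hyperexponential decay, built from a diverging monotone gain. -/
lemma classKInfty_integral_div {a : ℝ → ℝ} {η : ℝ} (hη : 0 < η) (ha : Continuous a)
    (ha0 : ∀ s, 0 < a s) (hmono : Monotone a) (hlim : Tendsto a atTop atTop) :
    ClassKInfty fun τ => η * (∫ r in (0 : ℝ)..τ, a r) / (1 + τ) := by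
  have hi : ∀ s t, IntervalIntegrable a volume s t := fun s t => ha.intervalIntegrable s t
  have hlow : ∀ s t, s ≤ t → (t - s) * a s ≤ ∫ r in s..t, a r := by
    intro s t hst
    have : ∫ _ in s..t, a s ≤ ∫ r in s..t, a r :=
      intervalIntegral.integral_mono_on hst (by simp) (hi _ _) fun r hr => hmono hr.1
    simpa using this
  have hup : ∀ s t, s ≤ t → ∫ r in s..t, a r ≤ (t - s) * a t := by
    intro s t hst
    have : ∫ r in s..t, a r ≤ ∫ _ in s..t, a t :=
      intervalIntegral.integral_mono_on hst (hi _ _) (by simp) fun r hr => hmono hr.2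
    simpa using this
  refine ⟨⟨?_, by simp, ?_⟩, ?_⟩
  · refine ContinuousOn.div ?_ (by fun_prop) fun t ht => ?_
    · exact (continuous_const.mul (intervalIntegral.continuous_primitive hi 0)).continuousOn
    · have : 0 ≤ t := ht
      positivity
  · intro s hs t ht hst
    have hs0 : 0 ≤ s := hs
    have ht0 : 0 ≤ t := ht
    have h1 := hlow s t hst.le
    have h2 := hup 0 s hs0
    have h3 := intervalIntegral.integral_add_adjacent_intervals (hi 0 s) (hi s t)
    have h4 := ha0 s
    -- Monotonicity bounds the difference of the two sides below by `(t - s) a(s) ((1 + s) - s)`.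
    -- The `1` in the denominator `1 + τ` is what makes the growth strict.
    have h5 : (∫ r in (0 : ℝ)..s, a r) * (1 + t) < (∫ r in (0 : ℝ)..t, a r) * (1 + s) := by
      rw [← h3]
      rw [sub_zero] at h2
      have e1 := mul_le_mul_of_nonneg_right h1 (by linarith : (0 : ℝ) ≤ 1 + s)
      have e2 := mul_le_mul_of_nonneg_right h2 (by linarith : (0 : ℝ) ≤ t - s)
      have e3 := mul_pos (sub_pos.2 hst) h4
      nlinarith
    simp only
    rw [div_lt_div_iff₀ (by linarith) (by linarith), mul_assoc, mul_assoc]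
    exact mul_lt_mul_of_pos_left h5 hη
  · have h1 : Tendsto (fun τ : ℝ => η / 4 * a (τ / 2)) atTop atTop :=
      (hlim.comp (tendsto_id.atTop_div_const (by norm_num))).const_mul_atTop (by positivity)
    refine tendsto_atTop_mono' _ ?_ h1
    filter_upwards [eventually_ge_atTop 1] with τ hτ
    have h2 := hlow (τ / 2) τ (by linarith)
    have h3 : 0 ≤ ∫ r in (0 : ℝ)..(τ / 2), a r :=
      intervalIntegral.integral_nonneg (by linarith) fun r _ => (ha0 r).le
    have h4 := intervalIntegral.integral_add_adjacent_intervals (hi 0 (τ / 2)) (hi (τ / 2) τ)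
    have h5 := ha0 (τ / 2)
    rw [le_div_iff₀ (by linarith), ← h4]
    have h6 : a (τ / 2) * (1 + τ) ≤ 4 * ((τ - τ / 2) * a (τ / 2)) := by nlinarith
    calc η / 4 * a (τ / 2) * (1 + τ) = η / 4 * (a (τ / 2) * (1 + τ)) := by ring
      _ ≤ η / 4 * (4 * ((τ - τ / 2) * a (τ / 2))) := by gcongr
      _ = η * ((τ - τ / 2) * a (τ / 2)) := by ring
      _ ≤ _ := by gcongr; linarith

end ComparisonFunctions

/-! ### Bounds for the disturbance integral. -/

section DisturbanceGain

variable {η t₀ t : ℝ}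

lemma continuous_exp_integral {a : ℝ → ℝ} (ha : Continuous a) (η t : ℝ) :
    Continuous fun s => Real.exp (-(η * ∫ r in s..t, a r)) := by
  have : ∀ s, ∫ r in s..t, a r = -∫ r in t..s, a r := fun s => intervalIntegral.integral_symm t s
  simp only [this]
  have := intervalIntegral.continuous_primitive (fun s t => ha.intervalIntegrable (μ := volume) s t) t
  fun_prop

/-- The influence of the disturbance decreases with the gain. -/
lemma integral_exp_div_le {a a' : ℝ → ℝ} (hη : 0 ≤ η) (ha : Continuous a) (ha' : Continuous a')
    (ht : t₀ ≤ t) (hpos : ∀ s ∈ Icc t₀ t, 0 < a' s) (hle : ∀ s ∈ Icc t₀ t, a' s ≤ a s) :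
    ∫ s in t₀..t, Real.exp (-(η * ∫ r in s..t, a r)) / a s ≤
      ∫ s in t₀..t, Real.exp (-(η * ∫ r in s..t, a' r)) / a' s := by
  have hpos' : ∀ s ∈ Icc t₀ t, 0 < a s := fun s hs => (hpos s hs).trans_le (hle s hs)
  refine intervalIntegral.integral_mono_on ht ?_ ?_ fun s hs => ?_
  · refine ContinuousOn.intervalIntegrable ?_
    rw [uIcc_of_le ht]
    exact (continuous_exp_integral ha η t).continuousOn.div ha.continuousOn
      fun s hs => (hpos' s hs).ne'
  · refine ContinuousOn.intervalIntegrable ?_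
    rw [uIcc_of_le ht]
    exact (continuous_exp_integral ha' η t).continuousOn.div ha'.continuousOn
      fun s hs => (hpos s hs).ne'
  · have h1 : ∫ r in s..t, a' r ≤ ∫ r in s..t, a r :=
      intervalIntegral.integral_mono_on hs.2 (ha'.intervalIntegrable _ _)
        (ha.intervalIntegrable _ _) fun r hr => hle r ⟨hs.1.trans hr.1, hr.2⟩
    have h2 := hpos s hs
    have h3 := hle s hs
    gcongr

lemma integral_exp_div_const_le {c : ℝ} (hη : 0 < η) (hc : 0 < c) :
    ∫ s in t₀..t, Real.exp (-(η * ∫ _ in s..t, c)) / c ≤ 1 / (η * c ^ 2) := by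
  have hd : ∀ s, HasDerivAt (fun s => Real.exp (-(η * ((t - s) * c))) / (η * c ^ 2))
      (Real.exp (-(η * ∫ _ in s..t, c)) / c) s := by
    intro s
    have h1 : HasDerivAt (fun s => -(η * ((t - s) * c))) (-(η * (-1 * c))) s :=
      ((((hasDerivAt_id s).const_sub t).mul_const c).const_mul η).neg
    refine (h1.exp.div_const _).congr_deriv ?_
    rw [intervalIntegral.integral_const, smul_eq_mul]
    field_simp
  rw [intervalIntegral.integral_eq_sub_of_hasDerivAt (fun s _ => hd s)
    (((continuous_exp_integral continuous_const η t).div_const c).intervalIntegrable _ _)]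
  have h2 : 0 < Real.exp (-(η * ((t - t₀) * c))) / (η * c ^ 2) := by positivity
  simp only [sub_self, zero_mul, mul_zero, neg_zero, Real.exp_zero]
  linarith

lemma integral_one_add (s t : ℝ) : ∫ r in s..t, (1 + r) = ((1 + t) ^ 2 - (1 + s) ^ 2) / 2 := by
  rw [intervalIntegral.integral_add (by simp) (by simp)]
  simp
  ring

/-- With `p = 1 + t`, `q = 1 + s` and `x = η(p² - q²)/4`, the integrand is `e^{-2x}/q`. One factor
`e^{-x}` pays for replacing `1/q` by `Cq/p²`, through `p² ≤ C q² e^x` with `C = 1 + 4/η`. The other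
leaves `q e^{-x}`, with antiderivative `(2/η) e^{-x}` in `s`. -/
lemma integral_exp_div_one_add_le (hη : 0 < η) (ht₀ : 0 ≤ t₀) (ht : t₀ ≤ t) :
    ∫ s in t₀..t, Real.exp (-(η * ∫ r in s..t, (1 + r))) / (1 + s) ≤
      (1 + 4 / η) * (2 / η) / (1 + t) ^ 2 := by
  have hp : 0 < 1 + t := by linarith
  set C := (1 + 4 / η) with hC
  have hCpos : 0 < C := by positivity
  have hd : ∀ s, HasDerivAt
      (fun s => C / (1 + t) ^ 2 * (2 / η * Real.exp (-(η * ((1 + t) ^ 2 - (1 + s) ^ 2) / 4))))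
      (C / (1 + t) ^ 2 * ((1 + s) * Real.exp (-(η * ((1 + t) ^ 2 - (1 + s) ^ 2) / 4)))) s := by
    intro s
    have h1 : HasDerivAt (fun s : ℝ => (1 + s) ^ 2) (2 * (1 + s)) s :=
      (((hasDerivAt_id s).const_add 1).pow 2).congr_deriv (by simp)
    have h2 : HasDerivAt (fun s => Real.exp (-(η * ((1 + t) ^ 2 - (1 + s) ^ 2) / 4)))
        (Real.exp (-(η * ((1 + t) ^ 2 - (1 + s) ^ 2) / 4)) * -(η * -(2 * (1 + s)) / 4)) s :=
      (((h1.const_sub ((1 + t) ^ 2)).const_mul η).div_const 4).neg.exp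
    refine ((h2.const_mul (2 / η)).const_mul (C / (1 + t) ^ 2)).congr_deriv ?_
    field_simp
    ring
  have hle : ∫ s in t₀..t, Real.exp (-(η * ∫ r in s..t, (1 + r))) / (1 + s) ≤
      ∫ s in t₀..t,
        C / (1 + t) ^ 2 * ((1 + s) * Real.exp (-(η * ((1 + t) ^ 2 - (1 + s) ^ 2) / 4))) := by
    refine intervalIntegral.integral_mono_on ht ?_
      (Continuous.intervalIntegrable (by fun_prop) _ _) fun s hs => ?_
    · refine ContinuousOn.intervalIntegrable ?_
      rw [uIcc_of_le ht]
      exact (continuous_exp_integral (by fun_prop) η t).continuousOn.div (by fun_prop)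
        fun s hs => by linarith [hs.1]
    · have hq : 1 ≤ 1 + s := by linarith [hs.1]
      have hqp : 1 + s ≤ 1 + t := by linarith [hs.2]
      have hq0 : 0 < 1 + s := by linarith
      rw [integral_one_add]
      generalize 1 + s = q at *
      generalize 1 + t = p at *
      have hx : 0 ≤ p ^ 2 - q ^ 2 := by nlinarith
      set x := η * (p ^ 2 - q ^ 2) / 4 with hxdef
      have e1 : Real.exp (-(η * ((p ^ 2 - q ^ 2) / 2))) = Real.exp (-x) * Real.exp (-x) := by
        rw [← Real.exp_add]
        congr 1
        rw [hxdef]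
        ring
      have hx0 : 0 ≤ x := by positivity
      have e2 : 1 + (p ^ 2 - q ^ 2) ≤ C * (1 + x) := by
        have : C * (1 + x) = 1 + 4 / η + x + (p ^ 2 - q ^ 2) := by
          rw [hC, hxdef]
          field_simp
          ring
        have h4 : 0 < 4 / η := by positivity
        linarith
      have e3 : p ^ 2 ≤ C * q ^ 2 * Real.exp x := by
        have h1 := Real.add_one_le_exp x
        have h2 : p ^ 2 ≤ q ^ 2 * (1 + (p ^ 2 - q ^ 2)) := by
          nlinarith [mul_nonneg (by nlinarith : 0 ≤ q ^ 2 - 1) hx]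
        calc p ^ 2 ≤ q ^ 2 * (1 + (p ^ 2 - q ^ 2)) := h2
          _ ≤ q ^ 2 * (C * (1 + x)) := by gcongr
          _ ≤ q ^ 2 * (C * Real.exp x) := by gcongr; linarith
          _ = _ := by ring
      have e4 : p ^ 2 * Real.exp (-x) ≤ C * q ^ 2 := by
        calc p ^ 2 * Real.exp (-x) ≤ C * q ^ 2 * Real.exp x * Real.exp (-x) := by gcongr
          _ = C * q ^ 2 := by rw [mul_assoc, ← Real.exp_add]; simp
      rw [e1, div_le_iff₀ hq0, div_mul_eq_mul_div, div_mul_eq_mul_div, le_div_iff₀ (by positivity)]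
      calc Real.exp (-x) * Real.exp (-x) * p ^ 2 = Real.exp (-x) * (p ^ 2 * Real.exp (-x)) := by
            ring
        _ ≤ Real.exp (-x) * (C * q ^ 2) := by gcongr
        _ = _ := by ring
  refine hle.trans ?_
  rw [intervalIntegral.integral_eq_sub_of_hasDerivAt (fun s _ => hd s)
    (Continuous.intervalIntegrable (by fun_prop) _ _)]
  have h3 : 0 < C / (1 + t) ^ 2 *
      (2 / η * Real.exp (-(η * ((1 + t) ^ 2 - (1 + t₀) ^ 2) / 4))) := by positivity
  simp only [sub_self, mul_zero, zero_div, neg_zero, Real.exp_zero, mul_one]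
  have h4 : C * (2 / η) / (1 + t) ^ 2 = C / (1 + t) ^ 2 * (2 / η) := by ring
  linarith

/-- Passing from the estimate of squares to the estimate of norms. -/
lemma le_exp_mul_add_of_sq_le {x E u W w D : ℝ} (hu : 0 ≤ u) (hw : 0 ≤ w) (hD : 0 ≤ D)
    (hW : W ≤ w ^ 2) (h : x ^ 2 ≤ Real.exp (-E) * u ^ 2 + W * D ^ 2) :
    x ≤ Real.exp (-(E / 2)) * u + w * D := by
  have h1 : Real.exp (-E) = Real.exp (-(E / 2)) ^ 2 := by
    rw [← Real.exp_nat_mul]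
    congr 1
    push_cast
    ring
  refine (abs_le_of_sq_le_sq' ?_ (by positivity)).2
  have h2 : 0 ≤ Real.exp (-(E / 2)) * u * (w * D) := by positivity
  rw [h1] at h
  have h3 : W * D ^ 2 ≤ w ^ 2 * D ^ 2 := by gcongr
  nlinarith

end DisturbanceGain

/-! ### Stability of the closed loop. -/

section ClosedLoop

variable {𝒳 : Type*} [NormedAddCommGroup 𝒳] [InnerProductSpace ℝ 𝒳] [CompleteSpace 𝒳]
  {A : 𝒳 →ₗ.[ℝ] 𝒳} {B : 𝒳 →L[ℝ] 𝒳} {K β n : ℝ} {ψ : ℝ → ℝ}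

/-- The energy estimate for mild solutions, with the gain replaced by a lower bound. -/
theorem IsMildSolution.norm_sq_le_of_le {d X : ℝ → 𝒳} {t₀ t : ℝ} {X₀ : 𝒳}
    (hX : IsMildSolution A (feedback K n ψ B) d t₀ X₀ X)
    (hB : CoerciveWith B β) (hKβ : 1 / 2 < K * β)
    (hψ : ContinuousOn ψ (Ici 0)) (hψ0 : ∀ t, 0 ≤ t → 0 < ψ t) (ht₀ : 0 ≤ t₀)
    (hd : d ∈ LInfty 𝒳) (ht : t₀ ≤ t) {a : ℝ → ℝ} (ha : Continuous a)
    (ha0 : ∀ s, 0 ≤ s → 0 < a s) (hle : ∀ s, 0 ≤ s → a s ≤ ψ s ^ n) :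
    ‖X t‖ ^ 2 ≤ Real.exp (-((2 * K * β - 1) * ∫ r in t₀..t, a r)) * ‖X₀‖ ^ 2 +
      (∫ s in t₀..t, Real.exp (-((2 * K * β - 1) * ∫ r in s..t, a r)) / a s) *
        supNorm d ^ 2 := by
  have hη : 0 ≤ 2 * K * β - 1 := by linarith
  have hac := continuous_gain (n := n) hψ hψ0
  have hle' : ∀ s ∈ Icc t₀ t, a s ≤ ψ (max s 0) ^ n := fun s hs => by
    rw [max_eq_left (ht₀.trans hs.1)]
    exact hle s (ht₀.trans hs.1)
  refine (hX.norm_sq_le hB hKβ hψ hψ0 ht₀ hd ht).trans ?_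
  have h1 : ∫ r in t₀..t, a r ≤ ∫ r in t₀..t, ψ (max r 0) ^ n :=
    intervalIntegral.integral_mono_on ht (ha.intervalIntegrable _ _)
      (hac.intervalIntegrable _ _) hle'
  have h2 := integral_exp_div_le hη hac ha ht (fun s hs => ha0 s (ht₀.trans hs.1)) hle'
  gcongr

/-- The energy estimate for mild solutions. -/
theorem IsMildSolution.norm_sq_le_gain {d X : ℝ → 𝒳} {t₀ t : ℝ} {X₀ : 𝒳}
    (hX : IsMildSolution A (feedback K n ψ B) d t₀ X₀ X)
    (hB : CoerciveWith B β) (hKβ : 1 / 2 < K * β)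
    (hψ : ContinuousOn ψ (Ici 0)) (hψ0 : ∀ t, 0 ≤ t → 0 < ψ t) (ht₀ : 0 ≤ t₀)
    (hd : d ∈ LInfty 𝒳) (ht : t₀ ≤ t) :
    ‖X t‖ ^ 2 ≤ Real.exp (-((2 * K * β - 1) * ∫ r in t₀..t, ψ r ^ n)) * ‖X₀‖ ^ 2 +
      (∫ s in t₀..t, Real.exp (-((2 * K * β - 1) * ∫ r in s..t, ψ r ^ n)) / ψ s ^ n) *
        supNorm d ^ 2 := by
  have h1 : ∀ s, 0 ≤ s → s ≤ t → ∫ r in s..t, ψ (max r 0) ^ n = ∫ r in s..t, ψ r ^ n := by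
    intro s hs hst
    refine intervalIntegral.integral_congr fun r hr => ?_
    rw [uIcc_of_le hst] at hr
    simp only [max_eq_left (hs.trans hr.1)]
  have h2 : ∫ s in t₀..t, Real.exp (-((2 * K * β - 1) * ∫ r in s..t, ψ (max r 0) ^ n)) /
        ψ (max s 0) ^ n =
      ∫ s in t₀..t, Real.exp (-((2 * K * β - 1) * ∫ r in s..t, ψ r ^ n)) / ψ s ^ n := by
    refine intervalIntegral.integral_congr fun s hs => ?_
    rw [uIcc_of_le ht] at hs
    simp only [max_eq_left (ht₀.trans hs.1), h1 s (ht₀.trans hs.1) hs.2]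
  have h := hX.norm_sq_le hB hKβ hψ hψ0 ht₀ hd ht
  rwa [h2, h1 t₀ ht₀ ht] at h

/-- The gain is at least the constant `c = ψ(0)^n`, for which the disturbance integral is at most
`1/(ηc²)`, uniformly in both times. Square roots give the rate `ηc/2` and the linear disturbance
gain. -/
theorem inputToStateStable_of_monotoneOn (hB : CoerciveWith B β) (hKβ : 1 / 2 < K * β)
    (hn : 0 ≤ n) (hψ : ContinuousOn ψ (Ici 0)) (hψ0 : ∀ t, 0 ≤ t → 0 < ψ t)
    (hmono : MonotoneOn ψ (Ici 0)) : InputToStateStable A (feedback K n ψ B) := by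
  have hη : 0 < 2 * K * β - 1 := by linarith
  set η := 2 * K * β - 1
  have hc : 0 < ψ 0 ^ n := Real.rpow_pos_of_pos (hψ0 0 le_rfl) n
  set c := ψ 0 ^ n
  have hle : ∀ s, 0 ≤ s → c ≤ ψ s ^ n := fun s hs =>
    Real.rpow_le_rpow (hψ0 0 le_rfl).le (hmono (mem_Ici.2 le_rfl) hs hs) hn
  refine ⟨_, _, classKL_mul_exp (show 0 < η * c / 2 by positivity),
    classKInfty_const_mul (show 0 < √(1 / (η * c ^ 2)) by positivity),
    fun t₀ ht₀ X₀ d hd X hX t ht => ?_⟩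
  have h := le_exp_mul_add_of_sq_le (norm_nonneg X₀) (Real.sqrt_nonneg _) (supNorm_nonneg d)
    ((integral_exp_div_const_le (t₀ := t₀) (t := t) hη hc).trans_eq
      (Real.sq_sqrt (by positivity)).symm)
    (hX.norm_sq_le_of_le hB hKβ hψ hψ0 ht₀ hd ht continuous_const (fun _ _ => hc) hle)
  refine h.trans (le_of_eq ?_)
  rw [intervalIntegral.integral_const, smul_eq_mul, mul_comm ‖X₀‖]
  congr 3
  ring

theorem uniformlyHyperexponentiallyStable_of_tendsto (hB : CoerciveWith B β)
    (hKβ : 1 / 2 < K * β) (hn : 0 < n) (hψ : ContinuousOn ψ (Ici 0))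
    (hψ0 : ∀ t, 0 ≤ t → 0 < ψ t) (hmono : MonotoneOn ψ (Ici 0)) (hlim : Tendsto ψ atTop atTop) :
    UniformlyHyperexponentiallyStable A (feedback K n ψ B) {0} := by
  have hη : 0 < 2 * K * β - 1 := by linarith
  have hac := continuous_gain (n := n) hψ hψ0
  have hamono : Monotone fun s => ψ (max s 0) ^ n := fun s t hst =>
    Real.rpow_le_rpow (hψ0 _ (le_max_right s 0)).le
      (hmono (mem_Ici.2 (le_max_right s 0)) (mem_Ici.2 (le_max_right t 0))
        (max_le_max_right 0 hst)) hn.le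
  have halim : Tendsto (fun s => ψ (max s 0) ^ n) atTop atTop :=
    (tendsto_rpow_atTop hn).comp (hlim.comp (tendsto_atTop_mono (fun s => le_max_left s 0) tendsto_id))
  -- The rate uses `η/2` because the estimate is for squares. The `𝒦ℒ` function is arbitrary, as it
  -- is evaluated at `supNorm 0 = 0`.
  refine ⟨0, _, _, _, le_rfl, classKInfty_id,
    classKInfty_integral_div (half_pos hη) hac (gain_pos hψ0) hamono halim,
    classKL_mul_exp one_pos, fun t₀ ht₀ X₀ d hd X hX t ht => ?_⟩
  obtain rfl : d = 0 := hd
  have h1 := hX.norm_sq_le hB hKβ hψ hψ0 ht₀ (MemLp.zero : (0 : ℝ → 𝒳) ∈ LInfty 𝒳) ht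
  rw [supNorm_zero] at h1 ⊢
  have h2 := le_exp_mul_add_of_sq_le (W := 0) (w := 0) (norm_nonneg X₀) le_rfl le_rfl (by simp)
    (h1.trans_eq (by ring))
  refine h2.trans ?_
  have hτ : 0 ≤ t - t₀ := sub_nonneg.2 ht
  -- A nondecreasing gain does at least as much from `t₀` to `t` as over an interval of the same
  -- length starting at `0`, so the rate does not depend on `t₀`.
  have h3 : ∫ r in (0 : ℝ)..(t - t₀), ψ (max r 0) ^ n ≤ ∫ r in t₀..t, ψ (max r 0) ^ n := by
    have e := intervalIntegral.integral_comp_add_right (a := 0) (b := t - t₀)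
      (fun r => ψ (max r 0) ^ n) t₀
    rw [zero_add, sub_add_cancel] at e
    rw [← e]
    exact intervalIntegral.integral_mono_on hτ (hac.intervalIntegrable _ _)
      (Continuous.intervalIntegrable (hac.comp (by fun_prop)) _ _)
      fun r _ => hamono (by linarith)
  have h4 : 0 ≤ ∫ r in (0 : ℝ)..(t - t₀), ψ (max r 0) ^ n :=
    intervalIntegral.integral_nonneg hτ fun r _ => (gain_pos hψ0 r).le
  rw [zero_mul, add_zero, zero_mul, add_zero, add_zero]
  gcongr
  rw [div_mul_eq_mul_div, div_le_iff₀ (by linarith)]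
  set F := ∫ r in (0 : ℝ)..(t - t₀), ψ (max r 0) ^ n
  set F' := ∫ r in t₀..t, ψ (max r 0) ^ n
  have h5 : F * (t - t₀) ≤ F' * (1 + (t - t₀)) :=
    mul_le_mul h3 (by linarith) hτ (h4.trans h3)
  nlinarith

/-- Since `1 + s ≥ 1` and `n ≥ 1`, the gain `(1 + s)^n` is at least `1 + s`; this makes the constant
independent of `n`. -/
theorem norm_sq_le_of_affine_gain {d X : ℝ → 𝒳} {t₀ t : ℝ} {X₀ : 𝒳} (hn : 1 ≤ n)
    (hX : IsMildSolution A (feedback K n ψ B) d t₀ X₀ X)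
    (hB : CoerciveWith B β) (hKβ : 1 / 2 < K * β)
    (hψ : ∀ t, 0 ≤ t → ψ t = 1 + t) (ht₀ : 0 ≤ t₀) (hd : d ∈ LInfty 𝒳) (ht : t₀ ≤ t) :
    ‖X t‖ ^ 2 ≤
      Real.exp (-((2 * K * β - 1) * (((1 + t) ^ 2 - (1 + t₀) ^ 2) / 2))) * ‖X₀‖ ^ 2 +
      (1 + 4 / (2 * K * β - 1)) * (2 / (2 * K * β - 1)) / (1 + t) ^ 2 * supNorm d ^ 2 := by
  have hη : 0 < 2 * K * β - 1 := by linarith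
  have hψc : ContinuousOn ψ (Ici 0) :=
    ContinuousOn.congr (f := fun t => 1 + t) (by fun_prop) fun t ht => hψ t ht
  have hψ0 : ∀ t, 0 ≤ t → 0 < ψ t := fun t ht => by rw [hψ t ht]; linarith
  have h := hX.norm_sq_le_of_le hB hKβ hψc hψ0 ht₀ hd ht (a := fun s => 1 + s) (by fun_prop)
    (fun s hs => by linarith) fun s hs => by
      rw [hψ s hs]
      exact Real.self_le_rpow_of_one_le (by linarith) hn
  rw [integral_one_add] at h
  refine h.trans ?_
  gcongr
  exact integral_exp_div_one_add_le hη ht₀ ht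

theorem uniformlyHyperexponentiallyStable_of_affine_gain (hn : 1 ≤ n) (hB : CoerciveWith B β)
    (hKβ : 1 / 2 < K * β) (hψ : ∀ t, 0 ≤ t → ψ t = 1 + t) :
    UniformlyHyperexponentiallyStable A (feedback K n ψ B) (LInfty 𝒳) := by
  have hη : 0 < 2 * K * β - 1 := by linarith
  set C := (1 + 4 / (2 * K * β - 1)) * (2 / (2 * K * β - 1)) with hC
  have hC0 : 0 < C := by positivity
  -- With `τ = t - t₀`, one has `((1+t)² - (1+t₀)²)/2 = τ²/2 + τ + t₀τ`. Dropping `t₀τ` and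
  -- multiplying by `η/2` gives the exponent `(ητ/4 + η/2)τ`.
  refine ⟨(2 * K * β - 1) / 2, _, _, _, by positivity, classKInfty_id,
    classKInfty_const_mul (show 0 < (2 * K * β - 1) / 4 by positivity),
    classKL_mul_div (Real.sqrt_pos.2 hC0), fun t₀ ht₀ X₀ d hd X hX t ht => ?_⟩
  have hτ : 0 ≤ t - t₀ := sub_nonneg.2 ht
  have h1 : C / (1 + t) ^ 2 ≤ (√C / (1 + (t - t₀))) ^ 2 := by
    rw [div_pow, Real.sq_sqrt hC0.le]
    gcongr
    linarith
  refine (le_exp_mul_add_of_sq_le (norm_nonneg X₀) (by positivity) (supNorm_nonneg d) h1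
    (norm_sq_le_of_affine_gain hn hX hB hKβ hψ ht₀ hd ht)).trans ?_
  rw [mul_comm (supNorm d)]
  gcongr
  nlinarith [mul_nonneg hη.le (mul_nonneg ht₀ hτ)]

end ClosedLoop

theorem theorem3 (K β η : ℝ) (hKβ : 1 / 2 < K * β) (hη : η = 2 * K * β - 1) :
    -- the constant `C` depends on `K` and `β` only
    ∃ C : ℝ, 0 < C ∧
      ∀ (𝒳 : Type*) [NormedAddCommGroup 𝒳] [InnerProductSpace ℝ 𝒳] [CompleteSpace 𝒳]
        (A : 𝒳 →ₗ.[ℝ] 𝒳) (B : 𝒳 →L[ℝ] 𝒳) (n : ℝ) (ψ : ℝ → ℝ),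
        MaximalMonotone A → CoerciveWith B β → 1 ≤ n →
        ContinuousOn ψ (Ici 0) → (∀ t : ℝ, 0 ≤ t → 0 < ψ t) →
        -- the closed-loop operators are maximal monotone (m-accretive)
        (∀ t : ℝ, 0 ≤ t → MaximalMonotone (((K * ψ t ^ n) • (B : 𝒳 →ₗ[ℝ] 𝒳)) +ᵥ A)) ∧
        -- existence and uniqueness of the mild solution
        (∀ t₀ : ℝ, 0 ≤ t₀ → ∀ (X₀ : 𝒳), ∀ d ∈ LInfty 𝒳,
          (∃ X : ℝ → 𝒳, IsMildSolution A (feedback K n ψ B) d t₀ X₀ X) ∧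
          ∀ X Y : ℝ → 𝒳, IsMildSolution A (feedback K n ψ B) d t₀ X₀ X →
            IsMildSolution A (feedback K n ψ B) d t₀ X₀ Y → EqOn X Y (Ici t₀)) ∧
        -- the estimate for a general gain function
        (∀ (X₀ : 𝒳), ∀ d ∈ LInfty 𝒳, ∀ X : ℝ → 𝒳,
          IsMildSolution A (feedback K n ψ B) d 0 X₀ X → ∀ t : ℝ, 0 ≤ t →
            ‖X t‖ ^ 2 ≤ Real.exp (-(η * ∫ r in (0 : ℝ)..t, ψ r ^ n)) * ‖X₀‖ ^ 2 +
              (∫ s in (0 : ℝ)..t, Real.exp (-(η * ∫ r in s..t, ψ r ^ n)) / ψ s ^ n) *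
                supNorm d ^ 2) ∧
        -- stability for nondecreasing gain functions
        (MonotoneOn ψ (Ici 0) →
          InputToStateStable A (feedback K n ψ B) ∧
          (Tendsto ψ atTop atTop →
            UniformlyHyperexponentiallyStable A (feedback K n ψ B) {0})) ∧
        -- the explicit rate for the gain function `ψ(t) = 1 + t`
        ((∀ t : ℝ, 0 ≤ t → ψ t = 1 + t) →
          (∀ (X₀ : 𝒳), ∀ d ∈ LInfty 𝒳, ∀ X : ℝ → 𝒳,
            IsMildSolution A (feedback K n ψ B) d 0 X₀ X → ∀ t : ℝ, 0 ≤ t →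
              ‖X t‖ ^ 2 ≤ Real.exp (-(η * t * (t + 2) / 2)) * ‖X₀‖ ^ 2 +
                C / ψ t ^ 2 * supNorm d ^ 2) ∧
          UniformlyHyperexponentiallyStable A (feedback K n ψ B) (LInfty 𝒳)) := by
  subst hη
  have hη : 0 < 2 * K * β - 1 := by linarith
  refine ⟨(1 + 4 / (2 * K * β - 1)) * (2 / (2 * K * β - 1)), by positivity, ?_⟩
  intro 𝒳 _ _ _ A B n ψ hA hB hn hψ hψ0
  have hK : 0 ≤ K := by
    by_contra! h
    nlinarith [hB.1]
  refine ⟨fun t ht => ?_, fun t₀ ht₀ X₀ d hd => ⟨hA.exists_mildSolution hψ hψ0 ht₀ X₀ hd,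
    fun X Y hX hY => hX.eqOn hA hY hB hKβ hψ hψ0 ht₀⟩, fun X₀ d hd X hX t ht =>
    hX.norm_sq_le_gain hB hKβ hψ hψ0 le_rfl hd ht, fun hmono =>
    ⟨inputToStateStable_of_monotoneOn hB hKβ (by linarith) hψ hψ0 hmono,
      uniformlyHyperexponentiallyStable_of_tendsto hB hKβ (by linarith) hψ hψ0 hmono⟩,
    fun hψa => ⟨fun X₀ d hd X hX t ht => ?_,
      uniformlyHyperexponentiallyStable_of_affine_gain hn hB hKβ hψa⟩⟩
  · refine hA.vadd ((K * ψ t ^ n) • B) fun x => ?_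
    rw [smul_apply, real_inner_smul_left]
    have h1 := Real.rpow_nonneg (hψ0 t ht).le n
    have h2 : 0 ≤ ⟪B x, x⟫_ℝ := (mul_nonneg hB.1.le (sq_nonneg _)).trans (hB.2 x)
    positivity
  · rw [hψa t ht]
    refine (norm_sq_le_of_affine_gain hn hX hB hKβ hψa le_rfl hd ht).trans (le_of_eq ?_)
    congr 3
    ring
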